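/- **Factorization of $\psi$.** For $b\in\mathbb C$ with $\operatorname{Re} b\ne 0$ put $q=e^{i\pi b^2}$, $\tilde q=e^{-i\pi/b^2}$, and for $|q|<1$ let $s_q(w)=\prod_{n\ge 0}(1+q^{2n+1}w)$ be the $q$-exponential. Let $$\psi(p)=\psi_b(p)=\exp\left(\frac14\int_{\mathbb R+i\varepsilon}\frac{e^{ip\xi/\pi}}{\sinh(b\xi)\,\sinh(\xi/b)}\,\frac{d\xi}{\xi}\right),\qquad |\operatorname{Im}p|<\pi\bigl(|\operatorname{Re}b|+|\operatorname{Re}(1/b)|\bigr),$$ where the contour passes above the pole $\xi=0$ and below all the other poles in the upper half-plane, that is, $0<\varepsilon<\pi\min(|\operatorname{Re}b|,|\operatorname{Re}(1/b)|)$. (1) Let $\operatorname{Im} b^2>0$. Then $|q|<1$ and $|\tilde q|<1$, the products $s_q(e^{bp})$ and $s_{\tilde q}(e^{p/b})$ converge, and for all $p$ in the strip above: * if $\operatorname{Re}b<0$, then $\psi(p)\,s_{\tilde q}(e^{p/b})=s_q(e^{bp})$, hence $$\psi(p)=\frac{s_q(e^{bp})}{s_{\tilde q}(e^{p/b})}\quad\text{whenever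 } s_{\tilde q}(e^{p/b})\neq 0;$$ * if $\operatorname{Re}b>0$, then the same holds with $e^{-ip\xi/\pi}$ in place of $e^{ip\xi/\pi}$ in the integral: $\psi(-p)\,s_{\tilde q}(e^{p/b})=s_q(e^{bp})$, hence $$\psi(-p)=\frac{s_q(e^{bp})}{s_{\tilde q}(e^{p/b})}\quad\text{whenever } s_{\tilde q}(e^{p/b})\neq 0.$$ (2) $\psi$ has no small-denominator problem: for every $b$ with $\operatorname{Re}b\neq0$, including real $b$, where $|q|=1$, an admissible $\varepsilon$ exists, the integral converges absolutely for all $p$ in the strip, $\psi$ does not depend on the choice of the admissible $\varepsilon$, and $\psi$ is holomorphic in $p$ on the strip. For fixed $\varepsilon$, $\psi_b(p)$ is jointly continuous in $(b,p)$ on the set of pairs for which $\operatorname{Re} b\ne0$, $\varepsilon$ is admissible for $b$, and $p$ lies in the strip. -/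

import Mathlib

noncomputable section

namespace ModularDouble

/-- The `q`-exponential `s_q(w) = ∏_{n ≥ 0} (1 + q^(2n+1) w)`; the product converges for `|q| < 1`. -/
def qExp (q w : ℂ) : ℂ := ∏' n : ℕ, (1 + q ^ (2 * n + 1) * w)

/-- `q = exp(iπb²)`. -/
def qParam (b : ℂ) : ℂ := Complex.exp (Complex.I * Real.pi * b ^ 2)

/-- `q̃ = exp(-iπ/b²)`. -/
def qDual (b : ℂ) : ℂ := Complex.exp (-(Complex.I * Real.pi) / b ^ 2)

/-- The integrand `e^{ipξ/π} / (sinh(bξ) sinh(ξ/b) ξ)`. -/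
def psiIntegrand (b p ξ : ℂ) : ℂ :=
  Complex.exp (Complex.I * p * ξ / Real.pi) / (Complex.sinh (b * ξ) * Complex.sinh (ξ / b)) / ξ

/-- `ψ(p) = exp (1/4 ∫ e^{ipξ/π} / (sinh(bξ) sinh(ξ/b)) dξ/ξ)`, integrated from left to right along
the horizontal line `ℝ + iε`, which for `ε > 0` passes above the singularity at `ξ = 0`. -/
def psi (b : ℂ) (ε : ℝ) (p : ℂ) : ℂ :=
  Complex.exp (1 / 4 * ∫ x : ℝ, psiIntegrand b p (x + ε * Complex.I))

/-- The poles of the integrand are `0`, `iπn/b` and `iπnb` with `n` a nonzero integer. A height is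
admissible if the line `ℝ + iε` lies above `0` and below every other pole of the upper half-plane. -/
def AdmissibleHeight (b : ℂ) (ε : ℝ) : Prop :=
  0 < ε ∧ ε < Real.pi * |b.re| ∧ ε < Real.pi * |(b⁻¹).re|

/-- The strip `|Im p| < π (|Re b| + |Re (1/b)|)`, in which the integrand decays exponentially. -/
def InStrip (b p : ℂ) : Prop :=
  |p.im| < Real.pi * (|b.re| + |(b⁻¹).re|)

end ModularDouble

end

section

open Complex Filter Topology MeasureTheory Set

namespace ModularDouble

/-! ### The `q`-exponential -/

/-! Since ψ is even in `b`, it suffices to treat Re b > 0, and there the factorization is proved in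
the variable -p. No residue series is summed: both sides are compared through difference equations.

Replacing p by p ∓ πib multiplies the integrand of ψ by e^{±bξ}. The difference of the two
integrands carries 2 sinh(bξ), which cancels one denominator and leaves a Fourier integral of 1/(ξ
sinh(ξ/b)). Its p-derivative is the Fourier transform of 1/sinh, known in closed form from the
antiperiodicity of sinh and the residue at 0, so its exponential is elementary
(`exp_integral_kernel_div_mul`). This gives `psi_sub_mul`, and the symmetry b ↔ 1/b gives a second
equation. The products s_q(e^{-bp}) and s_q̃(e^{-p/b}) satisfy matching equations by `qExp_inv_mul`.

Hence the quotient Q = ψ · s_q̃ / s_q has the periods 2πib and 2πi/b as long as the points stay in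
the strip. When Im b² > 0, suitable signs of these periods both move to the right, one downwards and
one upwards, so an orbit can run to Re p = +∞ inside the strip, where Q tends to 1
(`eq_one_of_two_periods`). Countably many heights escape this argument and are recovered by
continuity.

Regularity of ψ needs only exponential decay of the weight, uniform on compact sets of parameters
(`exists_norm_inv_sinh_le`), and a contour shift; |q| plays no role in it. -/

lemma summable_norm_pow_odd_mul {q : ℂ} (hq : ‖q‖ < 1) (r : ℝ) :
    Summable fun n : ℕ => ‖q‖ ^ (2 * n + 1) * r := by
  have h : Function.Injective fun n : ℕ => 2 * n + 1 := fun a b hab => by simpa using hab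
  exact ((summable_geometric_of_lt_one (norm_nonneg q) hq).comp_injective h).mul_right r

lemma multipliable_qExp {q : ℂ} (hq : ‖q‖ < 1) (w : ℂ) :
    Multipliable fun n : ℕ => 1 + q ^ (2 * n + 1) * w :=
  multipliable_one_add_of_summable (by simpa using summable_norm_pow_odd_mul hq ‖w‖)

lemma continuous_qExp {q : ℂ} (hq : ‖q‖ < 1) : Continuous (qExp q) := by
  refine continuous_iff_continuousAt.2 fun w₀ => ?_
  refine tendsto_tprod_one_add_of_dominated_convergence
    (summable_norm_pow_odd_mul hq (‖w₀‖ + 1)) (fun k => ?_) ?_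
  · exact (continuous_const.mul continuous_id).tendsto w₀
  · filter_upwards [continuous_norm.continuousAt.eventually_lt
      (continuousAt_const (y := ‖w₀‖ + 1)) (by simp)] with w hw k
    rw [norm_mul, norm_pow]
    gcongr

lemma qExp_zero (q : ℂ) : qExp q 0 = 1 := by simp [qExp]

/-- Multiplying the argument by q² moves each factor to the next one, so only the first factor is
lost. -/
lemma qExp_inv_mul {q : ℂ} (hq : ‖q‖ < 1) (h0 : q ≠ 0) (w : ℂ) :
    qExp q (q⁻¹ * w) = (1 + w) * qExp q (q * w) := by
  have key : ∀ n : ℕ, 1 + q ^ (2 * (n + 1) + 1) * (q⁻¹ * w) = 1 + q ^ (2 * n + 1) * (q * w) := by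
    intro n
    field_simp
    ring
  unfold qExp
  rw [tprod_eq_zero_mul' (by simpa only [key] using multipliable_qExp hq (q * w))]
  simp only [key, mul_zero, zero_add, pow_one, mul_inv_cancel_left₀ h0]

/-! ### The hyperbolic sine on horizontal lines -/

lemma exp_abs_re_le_norm_sinh {z : ℂ} (h : 1 ≤ |z.re|) :
    Real.exp |z.re| ≤ 4 * ‖sinh z‖ := by
  have h1 : |Real.exp z.re - Real.exp (-z.re)| ≤ 2 * ‖sinh z‖ := by
    have h2 := abs_norm_sub_norm_le (exp z) (exp (-z))
    rw [norm_exp, norm_exp, neg_re] at h2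
    rw [sinh, norm_div, Complex.norm_ofNat]
    linarith
  -- For r ≥ 1 one has e^r ≥ 2 ≥ 2e^{-r}, which costs a factor 2; the definition of sinh costs
  -- another.
  have h3 : ∀ r : ℝ, 1 ≤ r → Real.exp r ≤ 2 * (Real.exp r - Real.exp (-r)) := by
    intro r hr
    have h4 : Real.exp (-r) ≤ 1 := Real.exp_le_one_iff.2 (by linarith)
    linarith [Real.add_one_le_exp r]
  rcases abs_cases z.re with ⟨h5, h6⟩ | ⟨h5, h6⟩ <;> rw [h5] at h ⊢
  · linarith [h3 _ h, le_abs_self (Real.exp z.re - Real.exp (-z.re))]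
  · have := h3 _ h
    rw [neg_neg] at this
    linarith [neg_le_abs (Real.exp z.re - Real.exp (-z.re))]

lemma norm_inv_sinh_le_of_le {c : ℂ} {x y : ℝ} (h : |c.im| * |y| + 1 ≤ |c.re| * |x|) :
    ‖(sinh (c * (x + y * I)))⁻¹‖ ≤ 4 * Real.exp (|c.im| * |y|) * Real.exp (-(|c.re| * |x|)) := by
  have hre : (c * (x + y * I)).re = c.re * x - c.im * y := by simp
  have h1 : |c.re| * |x| - |c.im| * |y| ≤ |(c * (x + y * I)).re| := by
    rw [hre, ← abs_mul, ← abs_mul]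
    exact abs_sub_abs_le_abs_sub _ _
  have h2 := exp_abs_re_le_norm_sinh (z := c * (x + y * I)) (by linarith)
  have h3 : Real.exp (|c.re| * |x| - |c.im| * |y|) ≤ 4 * ‖sinh (c * (x + y * I))‖ :=
    (Real.exp_le_exp.2 h1).trans h2
  have h4 : 0 < ‖sinh (c * (x + y * I))‖ := by
    linarith [Real.exp_pos (|c.re| * |x| - |c.im| * |y|)]
  rw [norm_inv, inv_le_iff_one_le_mul₀ h4]
  rw [Real.exp_sub, div_le_iff₀ (Real.exp_pos _)] at h3
  rw [Real.exp_neg]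
  have h5 := Real.exp_pos (|c.re| * |x|)
  field_simp
  linarith

/-- The zeros are iπn/c, at height πn Re(1/c), so the bound on the height leaves only n = 0. -/
lemma eq_zero_of_sinh_eq_zero {c z : ℂ} (hc : c ≠ 0) (hz : |z.im| < Real.pi * |(c⁻¹).re|)
    (h : sinh (c * z) = 0) : z = 0 := by
  have h1 : sin (c * z * I) = 0 := by rw [sin_mul_I, h, zero_mul]
  obtain ⟨n, hn⟩ := Complex.sin_eq_zero_iff.1 h1
  have h2 : z = -((n * Real.pi : ℝ) : ℂ) * I * c⁻¹ := by
    have h3 : c * z = -(n * Real.pi) * I := by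
      rw [← hn]
      linear_combination (c * z) * I_mul_I
    push_cast
    rw [← h3]
    field_simp
  rcases eq_or_ne n 0 with rfl | hn0
  · simpa using h2
  · exfalso
    have h4 : z.im = -(n * Real.pi) * (c⁻¹).re := by
      rw [h2]
      simp only [mul_im, mul_re, neg_re, neg_im, ofReal_re, ofReal_im, I_re, I_im]
      ring
    rw [h4, abs_mul, abs_neg, abs_mul, abs_of_pos Real.pi_pos] at hz
    have h5 : (1 : ℝ) ≤ |(n : ℝ)| := by exact_mod_cast Int.one_le_abs hn0
    have h6 : 0 ≤ Real.pi * |(c⁻¹).re| := by positivity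
    nlinarith

lemma sinh_line_ne_zero {c : ℂ} {y : ℝ} (hc : c ≠ 0) (h0 : y ≠ 0)
    (hy : |y| < Real.pi * |(c⁻¹).re|) (x : ℝ) : sinh (c * (x + y * I)) ≠ 0 := by
  intro h
  have := congrArg im (eq_zero_of_sinh_eq_zero hc (by simpa using hy) h)
  exact h0 (by simpa using this)

/-- For large |x| the explicit bound applies, with a threshold `X` common to all of `K`; the
remaining set of parameters is compact. Uniformity is needed in the height for contour shifts and in
c for continuity in b. -/
lemma exists_norm_inv_sinh_le {K : Set (ℂ × ℝ)} (hK : IsCompact K) (hre : ∀ k ∈ K, k.1.re ≠ 0)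
    (h0 : ∀ k ∈ K, ∀ x : ℝ, sinh (k.1 * (x + k.2 * I)) ≠ 0) :
    ∃ C, ∀ k ∈ K, ∀ x : ℝ,
      ‖(sinh (k.1 * (x + k.2 * I)))⁻¹‖ ≤ C * Real.exp (-(|k.1.re| * |x|)) := by
  have hcont : ContinuousOn (fun k : ℂ × ℝ => (|k.1.im| * |k.2| + 1) / |k.1.re|) K := by
    refine ContinuousOn.div (by fun_prop) (by fun_prop) fun k hk => ?_
    simpa using hre k hk
  obtain ⟨X, hX⟩ := hK.exists_bound_of_continuousOn hcont
  have hcont' : ContinuousOn (fun k : ℂ × ℝ => 4 * Real.exp (|k.1.im| * |k.2|)) K := by fun_prop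
  obtain ⟨C₁, hC₁⟩ := hK.exists_bound_of_continuousOn hcont'
  have hcont'' : ContinuousOn (fun m : (ℂ × ℝ) × ℝ =>
      ‖(sinh (m.1.1 * (m.2 + m.1.2 * I)))⁻¹‖ * Real.exp (|m.1.1.re| * |m.2|))
      (K ×ˢ Icc (-X) X) := by
    refine ContinuousOn.mul (ContinuousOn.norm (ContinuousOn.inv₀ ?_ ?_)) (by fun_prop)
    · exact Continuous.continuousOn (by fun_prop)
    · exact fun m hm => h0 m.1 hm.1 m.2
  obtain ⟨C₂, hC₂⟩ := (hK.prod isCompact_Icc).exists_bound_of_continuousOn hcont''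
  refine ⟨max C₁ C₂, fun k hk x => ?_⟩
  rcases le_total |x| X with hx | hx
  · have h1 := (Real.le_norm_self _).trans (hC₂ (k, x) ⟨hk, abs_le.1 hx⟩)
    rw [← le_div_iff₀ (Real.exp_pos _), div_eq_mul_inv, ← Real.exp_neg] at h1
    exact h1.trans (by gcongr; exact le_max_right _ _)
  · have h1 : |k.1.im| * |k.2| + 1 ≤ |k.1.re| * |x| := by
      have h2 := ((Real.le_norm_self _).trans (hX k hk)).trans hx
      rwa [div_le_iff₀ (abs_pos.2 (hre k hk)), mul_comm |x|] at h2
    refine (norm_inv_sinh_le_of_le h1).trans ?_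
    gcongr
    exact ((Real.le_norm_self _).trans (hC₁ k hk)).trans (le_max_left _ _)

lemma integrable_exp_neg_mul_abs {κ : ℝ} (hκ : 0 < κ) :
    Integrable fun x : ℝ => Real.exp (-(κ * |x|)) := by
  rw [← integrableOn_univ, ← Iic_union_Ioi (a := (0 : ℝ))]
  refine IntegrableOn.union ?_ ?_
  · refine (integrableOn_exp_mul_Iic hκ 0).congr_fun (fun x hx => ?_) measurableSet_Iic
    simp only [abs_of_nonpos (mem_Iic.1 hx)]
    ring_nf
  · refine (integrableOn_exp_mul_Ioi (neg_lt_zero.2 hκ) 0).congr_fun (fun x hx => ?_)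
      measurableSet_Ioi
    simp only [abs_of_pos (mem_Ioi.1 hx)]
    ring_nf

/-! ### Shifting a horizontal line of integration -/

/-- Cauchy's theorem on rectangles whose vertical sides are negligible. Only the difference of the
two lines is assumed integrable, because a tail of size 1/z, as left by subtracting a principal
part, is not absolutely integrable on either line. The set `s` admits a removable singularity. -/
lemma integral_line_sub_line_eq_zero {g : ℂ → ℂ} {y₁ y₂ : ℝ} (hy : y₁ ≤ y₂) {s : Set ℂ}
    (hs : s.Countable) (hc : ContinuousOn g {z | z.im ∈ Icc y₁ y₂})
    (hd : ∀ z, z.im ∈ Ioo y₁ y₂ → z ∉ s → DifferentiableAt ℂ g z) {φ : ℝ → ℝ}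
    (hφ : Tendsto φ atTop (𝓝 0))
    (hb : ∀ᶠ R in atTop, ∀ z : ℂ, z.im ∈ Icc y₁ y₂ → |z.re| = R → ‖g z‖ ≤ φ R)
    (hi : Integrable fun x : ℝ => g (x + y₁ * I) - g (x + y₂ * I)) :
    ∫ x : ℝ, (g (x + y₁ * I) - g (x + y₂ * I)) = 0 := by
  refine tendsto_nhds_unique
    (intervalIntegral_tendsto_integral hi tendsto_neg_atTop_atBot tendsto_id) ?_
  refine squeeze_zero_norm' (a := fun R => 2 * (φ R * |y₂ - y₁|)) ?_
    (by simpa using (hφ.mul_const |y₂ - y₁|).const_mul 2)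
  filter_upwards [hb, eventually_ge_atTop 0] with R hR hR0
  have hline : ∀ y ∈ Icc y₁ y₂, IntervalIntegrable (fun x : ℝ => g (x + y * I)) volume (-R) R := by
    intro y hy'
    refine ContinuousOn.intervalIntegrable (hc.comp (by fun_prop) fun x _ => ?_)
    simpa using hy'
  have hside : ∀ r : ℝ, |r| = R → ‖∫ y in y₁..y₂, g (r + y * I)‖ ≤ φ R * |y₂ - y₁| := by
    intro r hr
    refine intervalIntegral.norm_integral_le_of_norm_le_const fun y hy' => ?_
    rw [uIoc_of_le hy] at hy'
    exact hR _ (by simpa using Ioc_subset_Icc_self hy') (by simpa using hr)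
  have hrect := integral_boundary_rect_eq_zero_of_differentiable_on_off_countable g
    ((-R : ℝ) + y₁ * I) ((R : ℝ) + y₂ * I) s hs
    (hc.mono fun z hz => by simpa [uIcc_of_le hy] using (mem_reProdIm.1 hz).2)
    (fun z hz => hd z (by simpa [hy] using (mem_reProdIm.1 hz.1).2) hz.2)
  simp only [add_re, add_im, ofReal_re, ofReal_im, mul_re, mul_im, I_re, I_im, mul_zero, mul_one,
    sub_zero, add_zero, zero_add] at hrect
  rw [id_eq,
    intervalIntegral.integral_sub (hline _ (left_mem_Icc.2 hy)) (hline _ (right_mem_Icc.2 hy))]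
  have h1 := hside R (abs_of_nonneg hR0)
  have h2 := hside (-R) (by rw [abs_neg, abs_of_nonneg hR0])
  have h3 : (∫ x in -R..R, g (x + y₁ * I)) - (∫ x in -R..R, g (x + y₂ * I)) =
      I • (∫ y in y₁..y₂, g ((-R : ℝ) + y * I)) - I • ∫ y in y₁..y₂, g ((R : ℝ) + y * I) := by
    linear_combination hrect
  rw [h3]
  refine (norm_sub_le _ _).trans ?_
  rw [norm_smul, norm_smul, norm_I, one_mul, one_mul]
  linarith

/-! ### Fourier integrals with exponentially decaying weight -/

lemma norm_kernel (p : ℂ) (x y : ℝ) :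
    ‖exp (I * p * (x + y * I) / Real.pi)‖ = Real.exp (-(p.im * x + p.re * y) / Real.pi) := by
  rw [norm_exp, div_ofReal_re]
  congr 2
  simp only [mul_re, mul_im, add_re, add_im, ofReal_re, ofReal_im, I_re, I_im]
  ring

lemma norm_kernel_mul_le {κ δ C x y A : ℝ} {p w : ℂ} (hp : |p.im| ≤ Real.pi * (κ - δ))
    (hA : -(p.re * y) ≤ A) (hw : ‖w‖ ≤ C * Real.exp (-(κ * |x|))) :
    ‖exp (I * p * (x + y * I) / Real.pi) * w‖ ≤
      Real.exp (A / Real.pi) * C * Real.exp (-(δ * |x|)) := by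
  have h1 : -(p.im * x + p.re * y) / Real.pi ≤ A / Real.pi + (κ - δ) * |x| := by
    rw [div_add' _ _ _ Real.pi_ne_zero]
    gcongr
    have h2 : -(p.im * x) ≤ |p.im| * |x| := by rw [← abs_mul]; exact neg_le_abs _
    have h3 := mul_le_mul_of_nonneg_right hp (abs_nonneg x)
    linarith
  have hC : 0 ≤ C * Real.exp (-(κ * |x|)) := (norm_nonneg _).trans hw
  rw [norm_mul, norm_kernel]
  calc _ ≤ Real.exp (A / Real.pi + (κ - δ) * |x|) * (C * Real.exp (-(κ * |x|))) := by gcongr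
    _ = Real.exp (A / Real.pi) * C * Real.exp ((κ - δ) * |x| + -(κ * |x|)) := by
      rw [Real.exp_add, Real.exp_add]
      ring
    _ = _ := by ring_nf

lemma integrable_kernel_mul {w : ℝ → ℂ} (hm : AEStronglyMeasurable w) {κ C : ℝ}
    (hw : ∀ x, ‖w x‖ ≤ C * Real.exp (-(κ * |x|))) {p : ℂ} (hp : |p.im| < Real.pi * κ) (y : ℝ) :
    Integrable fun x : ℝ => exp (I * p * (x + y * I) / Real.pi) * w x := by
  have hδ : 0 < κ - |p.im| / Real.pi := by
    rw [sub_pos, div_lt_iff₀ Real.pi_pos]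
    linarith
  refine ((integrable_exp_neg_mul_abs hδ).const_mul
    (Real.exp (-(p.re * y) / Real.pi) * C)).mono' ?_ ?_
  · exact (Continuous.aestronglyMeasurable (by fun_prop)).mul hm
  · refine Eventually.of_forall fun x => norm_kernel_mul_le ?_ le_rfl (hw x)
    rw [sub_sub_cancel, mul_div_cancel₀ _ Real.pi_ne_zero]

/-- For y > 0 the prefactor forces the integral to 0 as Re p → +∞; this is where having the contour
above the origin pays off. -/
lemma norm_integral_kernel_mul_le {w : ℝ → ℂ} {κ δ C : ℝ} (hδ : 0 < δ)
    (hw : ∀ x, ‖w x‖ ≤ C * Real.exp (-(κ * |x|))) {p : ℂ} (hp : |p.im| ≤ Real.pi * (κ - δ))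
    (y : ℝ) :
    ‖∫ x : ℝ, exp (I * p * (x + y * I) / Real.pi) * w x‖ ≤
      Real.exp (-(p.re * y) / Real.pi) * (C * ∫ x : ℝ, Real.exp (-(δ * |x|))) := by
  rw [← mul_assoc, ← integral_const_mul]
  refine norm_integral_le_of_norm_le ((integrable_exp_neg_mul_abs hδ).const_mul _) ?_
  exact Eventually.of_forall fun x => norm_kernel_mul_le hp le_rfl (hw x)

lemma hasDerivAt_integral_kernel_mul {w : ℝ → ℂ} (hm : AEStronglyMeasurable w) {κ C : ℝ}
    (hw : ∀ x, ‖w x‖ ≤ C * Real.exp (-(κ * |x|))) {p : ℂ} (hp : |p.im| < Real.pi * κ) (y : ℝ) :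
    HasDerivAt (fun p : ℂ => ∫ x : ℝ, exp (I * p * (x + y * I) / Real.pi) * w x)
      (∫ x : ℝ, I / Real.pi * (exp (I * p * (x + y * I) / Real.pi) * ((x + y * I) * w x))) p := by
  -- Two margins δ: one absorbs the linear factor produced by differentiation, the other keeps the
  -- dominating function integrable.
  obtain ⟨δ, hδ, hpδ⟩ : ∃ δ > 0, |p.im| < Real.pi * (κ - 2 * δ) := by
    refine ⟨(κ - |p.im| / Real.pi) / 4, ?_, ?_⟩
    · have : |p.im| / Real.pi < κ := by rw [div_lt_iff₀ Real.pi_pos]; linarith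
      linarith
    · have : Real.pi * (|p.im| / Real.pi) = |p.im| := mul_div_cancel₀ _ Real.pi_ne_zero
      linarith
  have hw' : ∀ x : ℝ, ‖(x + y * I) * w x‖ ≤
      (δ⁻¹ + |y|) * C * Real.exp (-((κ - δ) * |x|)) := by
    intro x
    have h1 : ‖(x + y * I : ℂ)‖ ≤ |x| + |y| := by
      simpa using norm_add_le (x : ℂ) (y * I)
    have h2 : |x| + |y| ≤ (δ⁻¹ + |y|) * Real.exp (δ * |x|) := by
      have h3 := Real.add_one_le_exp (δ * |x|)
      have h4 : |x| ≤ δ⁻¹ * Real.exp (δ * |x|) := by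
        rw [inv_mul_eq_div, le_div_iff₀ hδ]
        linarith
      have h5 : |y| * 1 ≤ |y| * Real.exp (δ * |x|) := by
        gcongr
        exact Real.one_le_exp (by positivity)
      linarith
    rw [norm_mul]
    calc _ ≤ (δ⁻¹ + |y|) * Real.exp (δ * |x|) * (C * Real.exp (-(κ * |x|))) := by
          gcongr
          · exact h1.trans h2
          · exact hw x
      _ = (δ⁻¹ + |y|) * C * Real.exp (δ * |x| + -(κ * |x|)) := by rw [Real.exp_add]; ring
      _ = _ := by ring_nf
  set s : Set ℂ := {p' | |p'.im| < Real.pi * (κ - 2 * δ) ∧ -(p'.re * y) < -(p.re * y) + 1}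
  have hs : s ∈ 𝓝 p := by
    have h1 : IsOpen {p' : ℂ | |p'.im| < Real.pi * (κ - 2 * δ)} :=
      isOpen_lt (by fun_prop) (by fun_prop)
    have h2 : IsOpen {p' : ℂ | -(p'.re * y) < -(p.re * y) + 1} :=
      isOpen_lt (by fun_prop) (by fun_prop)
    exact (h1.inter h2).mem_nhds ⟨hpδ, by simp⟩
  refine (hasDerivAt_integral_of_dominated_loc_of_deriv_le (s := s)
    (F := fun (p : ℂ) (x : ℝ) => exp (I * p * (x + y * I) / Real.pi) * w x)
    (F' := fun (p : ℂ) (x : ℝ) =>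
      I / Real.pi * (exp (I * p * (x + y * I) / Real.pi) * ((x + y * I) * w x)))
    (bound := fun x => ‖I / Real.pi‖ * (Real.exp ((-(p.re * y) + 1) / Real.pi) *
      ((δ⁻¹ + |y|) * C) * Real.exp (-(δ * |x|)))) hs ?_ ?_ ?_ ?_ ?_ ?_).2
  · exact Eventually.of_forall fun p' =>
      (Continuous.aestronglyMeasurable (by fun_prop)).mul hm
  · exact integrable_kernel_mul hm hw hp y
  · exact ((Continuous.aestronglyMeasurable (by fun_prop)).mul
      ((Continuous.aestronglyMeasurable (by fun_prop)).mul hm)).const_mul _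
  · refine Eventually.of_forall fun x p' hp' => ?_
    rw [norm_mul]
    gcongr
    refine norm_kernel_mul_le (κ := κ - δ) ?_ hp'.2.le (hw' x)
    exact hp'.1.le.trans_eq (by ring)
  · exact ((integrable_exp_neg_mul_abs hδ).const_mul _).const_mul _
  · refine Eventually.of_forall fun x p' _ => ?_
    have h1 : HasDerivAt (fun p : ℂ => I * p * (x + y * I) / Real.pi)
        (I * 1 * (x + y * I) / Real.pi) p' :=
      (((hasDerivAt_id p').const_mul I).mul_const _).div_const _
    exact ((h1.cexp).mul_const (w x)).congr_deriv (by ring)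

lemma integral_kernel_mul_eq {W : ℂ → ℂ} {y₁ y₂ κ C : ℝ} (hy : y₁ ≤ y₂)
    (hd : ∀ z : ℂ, z.im ∈ Icc y₁ y₂ → DifferentiableAt ℂ W z)
    (hW : ∀ y ∈ Icc y₁ y₂, ∀ x : ℝ, ‖W (x + y * I)‖ ≤ C * Real.exp (-(κ * |x|)))
    {p : ℂ} (hp : |p.im| < Real.pi * κ) :
    ∫ x : ℝ, exp (I * p * (x + y₁ * I) / Real.pi) * W (x + y₁ * I) =
      ∫ x : ℝ, exp (I * p * (x + y₂ * I) / Real.pi) * W (x + y₂ * I) := by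
  have hδ : 0 < κ - |p.im| / Real.pi := by
    rw [sub_pos, div_lt_iff₀ Real.pi_pos]
    linarith
  have hint : ∀ y ∈ Icc y₁ y₂, Integrable fun x : ℝ =>
      exp (I * p * (x + y * I) / Real.pi) * W (x + y * I) := by
    intro y hy'
    refine integrable_kernel_mul (w := fun x : ℝ => W (x + y * I)) ?_ (hW y hy') hp y
    refine Continuous.aestronglyMeasurable (continuous_iff_continuousAt.2 fun x => ?_)
    exact ContinuousAt.comp (f := fun x : ℝ => (x + y * I : ℂ))
      (hd _ (by simpa using hy')).continuousAt (by fun_prop)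
  rw [← sub_eq_zero, ← integral_sub (hint _ (left_mem_Icc.2 hy)) (hint _ (right_mem_Icc.2 hy))]
  have hdiff : ∀ z : ℂ, z.im ∈ Icc y₁ y₂ →
      DifferentiableAt ℂ (fun z => exp (I * p * z / Real.pi) * W z) z :=
    fun z hz => DifferentiableAt.mul (by fun_prop) (hd z hz)
  refine integral_line_sub_line_eq_zero (g := fun z => exp (I * p * z / Real.pi) * W z) hy
    countable_empty
    (fun z hz => (hdiff z hz).continuousAt.continuousWithinAt)
    (fun z hz _ => hdiff z (Ioo_subset_Icc_self hz))
    (φ := fun R => Real.exp (|p.re| * max |y₁| |y₂| / Real.pi) * C *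
      Real.exp (-((κ - |p.im| / Real.pi) * R))) ?_ ?_
    ((hint _ (left_mem_Icc.2 hy)).sub (hint _ (right_mem_Icc.2 hy)))
  · have h1 : Tendsto (fun R : ℝ => (κ - |p.im| / Real.pi) * R) atTop atTop :=
      tendsto_id.const_mul_atTop hδ
    simpa using (Real.tendsto_exp_neg_atTop_nhds_zero.comp h1).const_mul
      (Real.exp (|p.re| * max |y₁| |y₂| / Real.pi) * C)
  · refine Eventually.of_forall fun R z hz hR => ?_
    rw [← hR, ← re_add_im z]
    simp only [add_re, ofReal_re, mul_re, I_re, mul_zero, ofReal_im, I_im, mul_one, sub_self,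
      add_zero]
    refine norm_kernel_mul_le ?_ ?_ (hW _ hz _)
    · rw [sub_sub_cancel, mul_div_cancel₀ _ Real.pi_ne_zero]
    · refine (neg_le_abs _).trans ?_
      rw [abs_mul]
      gcongr
      exact abs_le_max_abs_abs hz.1 hz.2

/-! ### The contribution of a simple pole at the origin -/

/-- The difference is the Lorentzian 2ih/(x² + h²), integrable although neither term is. -/
lemma integral_inv_line_sub_inv_line {h : ℝ} (hh : 0 < h) :
    Integrable (fun x : ℝ => ((x + (-h : ℝ) * I : ℂ)⁻¹ - (x + h * I : ℂ)⁻¹)) ∧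
      ∫ x : ℝ, ((x + (-h : ℝ) * I : ℂ)⁻¹ - (x + h * I : ℂ)⁻¹) = 2 * Real.pi * I := by
  have h1 : ∀ x : ℝ, (x + (-h : ℝ) * I : ℂ)⁻¹ - (x + h * I : ℂ)⁻¹ =
      2 * I / h * (((1 + (x / h) ^ 2)⁻¹ : ℝ) : ℂ) := by
    intro x
    have hne : ∀ y : ℝ, y ≠ 0 → (x + y * I : ℂ) ≠ 0 := fun y hy hz =>
      hy (by simpa using congrArg im hz)
    have hm : (x - h * I : ℂ) ≠ 0 := by
      simpa [sub_eq_add_neg] using hne (-h) (neg_ne_zero.2 hh.ne')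
    have hp := hne h hh.ne'
    have hh' : (h : ℂ) ≠ 0 := ofReal_ne_zero.2 hh.ne'
    have h2 : (h ^ 2 + x ^ 2 : ℂ) = (x - h * I) * (x + h * I) := by
      linear_combination (h ^ 2 : ℂ) * I_sq
    have h3 : (h ^ 2 + x ^ 2 : ℂ) ≠ 0 := by rw [h2]; exact mul_ne_zero hm hp
    have h4 : (1 + (x / h) ^ 2 : ℂ) = (x - h * I) * (x + h * I) / h ^ 2 := by
      rw [← h2]
      field_simp
    push_cast
    rw [h4, neg_mul, ← sub_eq_add_neg]
    field_simp
    ring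
  simp only [h1]
  have h5 : Integrable fun x : ℝ => (((1 + (x / h) ^ 2)⁻¹ : ℝ) : ℂ) :=
    (integrable_inv_one_add_sq.comp_div hh.ne').ofReal
  refine ⟨h5.const_mul _, ?_⟩
  rw [integral_const_mul, integral_complex_ofReal,
    Measure.integral_comp_div (fun x : ℝ => (1 + x ^ 2)⁻¹) h, integral_univ_inv_one_add_sq,
    abs_of_pos hh, smul_eq_mul]
  have hh' : (h : ℂ) ≠ 0 := ofReal_ne_zero.2 hh.ne'
  push_cast
  field_simp

/-- Write u(z)/z = `dslope u 0 z` + u(0)/z away from 0. The first term is holomorphic across the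
band up to a removable point and contributes nothing; the second is computed explicitly. -/
lemma integral_line_sub_line_of_simple_pole {u : ℂ → ℂ} {h : ℝ} (hh : 0 < h)
    (hd : ∀ z : ℂ, z.im ∈ Icc (-h) h → DifferentiableAt ℂ u z) {φ : ℝ → ℝ}
    (hφ : Tendsto φ atTop (𝓝 0))
    (hb : ∀ᶠ R in atTop, ∀ z : ℂ, z.im ∈ Icc (-h) h → |z.re| = R → ‖u z / z‖ ≤ φ R)
    (hi₁ : Integrable fun x : ℝ => u (x + (-h : ℝ) * I) / (x + (-h : ℝ) * I))
    (hi₂ : Integrable fun x : ℝ => u (x + h * I) / (x + h * I)) :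
    (∫ x : ℝ, u (x + (-h : ℝ) * I) / (x + (-h : ℝ) * I)) - ∫ x : ℝ, u (x + h * I) / (x + h * I) =
      2 * Real.pi * I * u 0 := by
  have hg : ∀ z : ℂ, z ≠ 0 → dslope u 0 z = u z / z - u 0 * z⁻¹ := by
    intro z hz
    rw [dslope_of_ne _ hz, slope_def_field]
    field_simp
    ring
  have hne : ∀ y : ℝ, y ≠ 0 → ∀ x : ℝ, (x + y * I : ℂ) ≠ 0 := fun y hy x hz =>
    hy (by simpa using congrArg im hz)
  have hsub : ∀ x : ℝ, dslope u 0 (x + (-h : ℝ) * I) - dslope u 0 (x + h * I) =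
      (u (x + (-h : ℝ) * I) / (x + (-h : ℝ) * I) - u (x + h * I) / (x + h * I)) -
        u 0 * ((x + (-h : ℝ) * I : ℂ)⁻¹ - (x + h * I : ℂ)⁻¹) := by
    intro x
    rw [hg _ (hne _ (neg_ne_zero.2 hh.ne') x), hg _ (hne _ hh.ne' x)]
    ring
  obtain ⟨hpi, hpv⟩ := integral_inv_line_sub_inv_line hh
  have hint := (hi₁.sub hi₂).sub (hpi.const_mul (u 0))
  have hzero := integral_line_sub_line_eq_zero (g := dslope u 0) (y₁ := -h) (y₂ := h)
    (s := {0}) (φ := fun R => φ R + ‖u 0‖ * R⁻¹) (by linarith) (countable_singleton 0)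
    (fun z hz => ?_) (fun z hz hz0 => ?_) ?_ ?_
    (hint.congr (Eventually.of_forall fun x => (hsub x).symm))
  · simp only [hsub] at hzero
    have hi : Integrable fun x : ℝ =>
        u (x + (-h : ℝ) * I) / (x + (-h : ℝ) * I) - u (x + h * I) / (x + h * I) := hi₁.sub hi₂
    rw [integral_sub hi (hpi.const_mul (u 0)), integral_const_mul, hpv,
      integral_sub hi₁ hi₂] at hzero
    linear_combination hzero
  · refine ContinuousAt.continuousWithinAt ?_
    rcases eq_or_ne z 0 with rfl | hz0
    · exact continuousAt_dslope_same.2 (hd 0 hz)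
    · exact (continuousAt_dslope_of_ne hz0).2 (hd z hz).continuousAt
  · exact (differentiableAt_dslope_of_ne hz0).2 (hd z (Ioo_subset_Icc_self hz))
  · simpa using hφ.add (tendsto_inv_atTop_zero.const_mul ‖u 0‖)
  · filter_upwards [hb, eventually_gt_atTop 0] with R hR hR0 z hz hzR
    have hz0 : z ≠ 0 := by
      rintro rfl
      simp at hzR
      linarith
    rw [hg z hz0]
    refine (norm_sub_le _ _).trans (add_le_add (hR z hz hzR) ?_)
    rw [norm_mul, norm_inv]
    gcongr
    rw [← hzR]
    exact abs_re_le_norm z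

/-! ### The Fourier transform of `1 / sinh` -/

lemma ne_zero_of_re_ne_zero {c : ℂ} (hc : c.re ≠ 0) : c ≠ 0 := fun h => hc (by simp [h])

lemma inv_re_ne_zero {c : ℂ} (hc : c.re ≠ 0) : (c⁻¹).re ≠ 0 := by
  rw [inv_re]
  exact div_ne_zero hc (normSq_pos.2 (ne_zero_of_re_ne_zero hc)).ne'

lemma inv_re_pos {c : ℂ} (hc : 0 < c.re) : 0 < (c⁻¹).re := by
  rw [inv_re]
  exact div_pos hc (normSq_pos.2 (ne_zero_of_re_ne_zero hc.ne'))

lemma exists_norm_inv_sinh_line_le {c : ℂ} (hc : c.re ≠ 0) {y₁ y₂ : ℝ}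
    (hy : ∀ y ∈ Icc y₁ y₂, y ≠ 0 ∧ |y| < Real.pi * |(c⁻¹).re|) :
    ∃ C, ∀ y ∈ Icc y₁ y₂, ∀ x : ℝ,
      ‖(sinh (c * (x + y * I)))⁻¹‖ ≤ C * Real.exp (-(|c.re| * |x|)) := by
  obtain ⟨C, hC⟩ := exists_norm_inv_sinh_le (K := {c} ×ˢ Icc y₁ y₂)
    (isCompact_singleton.prod isCompact_Icc)
    (by rintro ⟨c', y⟩ ⟨rfl, -⟩; exact hc)
    (by
      rintro ⟨c', y⟩ ⟨rfl, hk⟩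
      exact sinh_line_ne_zero (ne_zero_of_re_ne_zero hc) (hy y hk).1 (hy y hk).2)
  exact ⟨C, fun y hy' x => hC (c, y) ⟨rfl, hy'⟩ x⟩

lemma continuous_inv_sinh_line {c : ℂ} (hc : c.re ≠ 0) {y : ℝ} (h0 : y ≠ 0)
    (hy : |y| < Real.pi * |(c⁻¹).re|) :
    Continuous fun x : ℝ => (sinh (c * (x + y * I)))⁻¹ :=
  Continuous.inv₀ (by fun_prop) (sinh_line_ne_zero (ne_zero_of_re_ne_zero hc) h0 hy)

lemma integrable_kernel_mul_inv_sinh {c p : ℂ} (hc : c.re ≠ 0) (hp : |p.im| < Real.pi * |c.re|)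
    {y : ℝ} (h0 : y ≠ 0) (hy : |y| < Real.pi * |(c⁻¹).re|) :
    Integrable fun x : ℝ => exp (I * p * (x + y * I) / Real.pi) * (sinh (c * (x + y * I)))⁻¹ := by
  obtain ⟨C, hC⟩ := exists_norm_inv_sinh_line_le hc (y₁ := y) (y₂ := y)
    (fun y' hy' => by rw [Icc_self] at hy'; subst hy'; exact ⟨h0, hy⟩)
  exact integrable_kernel_mul (continuous_inv_sinh_line hc h0 hy).aestronglyMeasurable
    (hC y (by simp)) hp y

lemma integral_kernel_mul_inv_sinh_sub {c p : ℂ} (hc : c.re ≠ 0)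
    (hp : |p.im| < Real.pi * |c.re|) {h : ℝ} (hh : 0 < h) (hy : h < Real.pi * |(c⁻¹).re|) :
    (∫ x : ℝ, exp (I * p * (x + (-h : ℝ) * I) / Real.pi) * (sinh (c * (x + (-h : ℝ) * I)))⁻¹) -
      ∫ x : ℝ, exp (I * p * (x + h * I) / Real.pi) * (sinh (c * (x + h * I)))⁻¹ =
      2 * Real.pi * I / c := by
  have hc0 := ne_zero_of_re_ne_zero hc
  -- `S` is the entire function sinh(cz)/z with value c at 0, so the integrand becomes u(z)/z with
  -- u(0) = 1/c.
  set S : ℂ → ℂ := dslope (fun z => sinh (c * z)) 0 with hS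
  have hSd : Differentiable ℂ S := by
    have h1 : DifferentiableOn ℂ (fun z => sinh (c * z)) univ := by fun_prop
    rw [← differentiableOn_univ]
    exact (differentiableOn_dslope univ_mem).2 h1
  have hS0 : S 0 = c := by
    have h1 : HasDerivAt (fun z => sinh (c * z)) (cosh (c * 0) * (c * 1)) 0 :=
      ((hasDerivAt_id (0 : ℂ)).const_mul c).csinh
    rw [hS, dslope_same, h1.deriv]
    simp
  have hSne : ∀ z : ℂ, z ≠ 0 → S z = sinh (c * z) / z := by
    intro z hz
    rw [hS, dslope_of_ne _ hz, slope_def_field]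
    simp
  set u : ℂ → ℂ := fun z => exp (I * p * z / Real.pi) * (S z)⁻¹ with hu
  have huz : ∀ z : ℂ, z ≠ 0 → u z / z = exp (I * p * z / Real.pi) * (sinh (c * z))⁻¹ := by
    intro z hz
    simp only [hu, hSne z hz]
    field_simp
  have hne : ∀ y : ℝ, y ≠ 0 → ∀ x : ℝ, (x + y * I : ℂ) ≠ 0 := fun y hy x hz =>
    hy (by simpa using congrArg im hz)
  have hline : ∀ y : ℝ, y ≠ 0 → (fun x : ℝ => u (x + y * I) / (x + y * I)) =
      fun x : ℝ => exp (I * p * (x + y * I) / Real.pi) * (sinh (c * (x + y * I)))⁻¹ :=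
    fun y hy => funext fun x => huz _ (hne y hy x)
  have hmain := integral_line_sub_line_of_simple_pole (u := u) hh (fun z hz => ?_)
    (φ := fun R => Real.exp (|p.re| * h / Real.pi) * (4 * Real.exp (|c.im| * h)) *
      Real.exp (-((|c.re| - |p.im| / Real.pi) * R))) ?_ ?_ ?_ ?_
  · rw [hline _ hh.ne', hline _ (neg_ne_zero.2 hh.ne')] at hmain
    rw [hmain]
    simp [hu, hS0, div_eq_mul_inv]
  · refine DifferentiableAt.mul (by fun_prop) ((hSd z).inv ?_)
    rcases eq_or_ne z 0 with rfl | hz0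
    · rwa [hS0]
    · rw [hSne z hz0]
      refine div_ne_zero (fun h0 => hz0 ?_) hz0
      exact eq_zero_of_sinh_eq_zero hc0 ((abs_le.2 hz).trans_lt hy) h0
  · have hδ : 0 < |c.re| - |p.im| / Real.pi := by
      rw [sub_pos, div_lt_iff₀ Real.pi_pos]
      linarith
    have h1 : Tendsto (fun R : ℝ => (|c.re| - |p.im| / Real.pi) * R) atTop atTop :=
      tendsto_id.const_mul_atTop hδ
    simpa using (Real.tendsto_exp_neg_atTop_nhds_zero.comp h1).const_mul
      (Real.exp (|p.re| * h / Real.pi) * (4 * Real.exp (|c.im| * h)))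
  · filter_upwards [eventually_gt_atTop 0,
      eventually_ge_atTop ((|c.im| * h + 1) / |c.re|)] with R hR0 hR z hz hzR
    rw [div_le_iff₀ (abs_pos.2 hc), mul_comm R, ← hzR] at hR
    have hz0 : z ≠ 0 := by
      rintro rfl
      simp at hzR
      linarith
    have hzh : |z.im| ≤ h := abs_le.2 hz
    rw [huz z hz0, ← hzR, ← re_add_im z]
    simp only [add_re, ofReal_re, mul_re, I_re, mul_zero, ofReal_im, I_im, mul_one, sub_self,
      add_zero]
    refine norm_kernel_mul_le (κ := |c.re|) ?_ ?_ ((norm_inv_sinh_le_of_le ?_).trans ?_)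
    · rw [sub_sub_cancel, mul_div_cancel₀ _ Real.pi_ne_zero]
    · refine (neg_le_abs _).trans ?_
      rw [abs_mul]
      gcongr
    · refine le_trans ?_ hR
      gcongr
    · gcongr
  · rw [hline _ (neg_ne_zero.2 hh.ne')]
    exact integrable_kernel_mul_inv_sinh hc hp (neg_ne_zero.2 hh.ne')
      (by rwa [abs_neg, abs_of_pos hh])
  · rw [hline _ hh.ne']
    exact integrable_kernel_mul_inv_sinh hc hp hh.ne' (by rwa [abs_of_pos hh])

/-- Translation by iπ/c flips the sign of sinh(cξ) and multiplies the kernel by e^{-p/c}. Combined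
with the residue at 0, this is a linear equation for the integral. -/
lemma integral_kernel_mul_inv_sinh {c p : ℂ} (hc : 0 < c.re) (hp : |p.im| < Real.pi * c.re)
    {ε : ℝ} (hε : 0 < ε) (hy : ε < Real.pi * (c⁻¹).re) :
    (1 + exp (p / c)) *
      ∫ x : ℝ, exp (I * p * (x + ε * I) / Real.pi) * (sinh (c * (x + ε * I)))⁻¹ =
      -(2 * Real.pi * I / c) := by
  have hc0 := ne_zero_of_re_ne_zero hc.ne'
  have ha := inv_re_pos hc
  have hpi := Real.pi_pos
  -- With this height, translation by iπ/c carries the line at -h onto the line at h; its real part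
  -- is absorbed by translation invariance.
  set h : ℝ := Real.pi * (c⁻¹).re / 2 with hh
  have hh0 : 0 < h := by positivity
  have hhlt : h < Real.pi * (c⁻¹).re := by linarith
  rw [← abs_of_pos hc] at hp
  rw [← abs_of_pos ha] at hy hhlt
  have hshift : ∀ y₁ y₂ : ℝ, 0 < y₁ → y₁ ≤ y₂ → y₂ < Real.pi * |(c⁻¹).re| →
      ∫ x : ℝ, exp (I * p * (x + y₁ * I) / Real.pi) * (sinh (c * (x + y₁ * I)))⁻¹ =
      ∫ x : ℝ, exp (I * p * (x + y₂ * I) / Real.pi) * (sinh (c * (x + y₂ * I)))⁻¹ := by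
    intro y₁ y₂ h1 h12 h2
    have hband : ∀ y ∈ Icc y₁ y₂, y ≠ 0 ∧ |y| < Real.pi * |(c⁻¹).re| := by
      intro y hy
      have : 0 < y := h1.trans_le hy.1
      exact ⟨this.ne', by rw [abs_of_pos this]; exact hy.2.trans_lt h2⟩
    obtain ⟨C, hC⟩ := exists_norm_inv_sinh_line_le hc.ne' hband
    refine integral_kernel_mul_eq (W := fun z => (sinh (c * z))⁻¹) h12 (fun z hz => ?_) hC hp
    refine DifferentiableAt.inv (by fun_prop) fun h0 => ?_
    have := eq_zero_of_sinh_eq_zero hc0 (hband _ hz).2 h0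
    exact (hband _ hz).1 (by simp [this])
  have hε_h : ∫ x : ℝ, exp (I * p * (x + ε * I) / Real.pi) * (sinh (c * (x + ε * I)))⁻¹ =
      ∫ x : ℝ, exp (I * p * (x + h * I) / Real.pi) * (sinh (c * (x + h * I)))⁻¹ := by
    rcases le_total ε h with hle | hle
    · exact hshift _ _ hε hle hhlt
    · exact (hshift _ _ hh0 hle hy).symm
  have hquasi : ∫ x : ℝ, exp (I * p * (x + h * I) / Real.pi) * (sinh (c * (x + h * I)))⁻¹ =
      -exp (-(p / c)) * ∫ x : ℝ, exp (I * p * (x + (-h : ℝ) * I) / Real.pi) *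
        (sinh (c * (x + (-h : ℝ) * I)))⁻¹ := by
    rw [← integral_add_right_eq_self _ (-(Real.pi * (c⁻¹).im)), ← integral_const_mul]
    congr 1
    funext x
    have h1 : (((x + -(Real.pi * (c⁻¹).im) : ℝ) : ℂ) + h * I : ℂ) =
        x + (-h : ℝ) * I + Real.pi * I * c⁻¹ := by
      apply Complex.ext
      · simp
      · simp [hh]
        ring
    have h2 : c * (x + (-h : ℝ) * I + Real.pi * I * c⁻¹) =
        c * (x + (-h : ℝ) * I) + Real.pi * I := by
      field_simp
    have h3 : I * p * (x + (-h : ℝ) * I + Real.pi * I * c⁻¹) / Real.pi =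
        I * p * (x + (-h : ℝ) * I) / Real.pi + -(p / c) := by
      have : (Real.pi : ℂ) ≠ 0 := ofReal_ne_zero.2 Real.pi_ne_zero
      field_simp
      linear_combination (p * Real.pi) * I_sq
    have h4 : ∀ w : ℂ, sinh (w + Real.pi * I) = -sinh w := by
      intro w
      rw [sinh_add, cosh_mul_I, sinh_mul_I]
      simp
    rw [h1, h2, h3, h4, Complex.exp_add, inv_neg]
    ring
  have hres := integral_kernel_mul_inv_sinh_sub hc.ne' hp hh0 hhlt
  rw [hε_h]
  have h5 : exp (p / c) * exp (-(p / c)) = 1 := by rw [← Complex.exp_add, add_neg_cancel, exp_zero]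
  linear_combination exp (p / c) * hquasi - hres - (∫ x : ℝ, exp (I * p * (x + (-h : ℝ) * I) /
    Real.pi) * (sinh (c * (x + (-h : ℝ) * I)))⁻¹) * h5

/-! ### The elementary factor -/

/-- Along p + t with t real, the left side has zero derivative, as the Fourier transform of 1/sinh
shows, and it tends to 1 as t → +∞. Working with the exponential avoids choosing a branch of the
logarithm. -/
lemma exp_integral_kernel_div_mul {c : ℂ} (hc : 0 < c.re) {ε : ℝ} (hε : 0 < ε)
    (hy : ε < Real.pi * (c⁻¹).re) {p : ℂ} (hp : |p.im| < Real.pi * c.re) :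
    exp (1 / 2 * ∫ x : ℝ, exp (I * p * (x + ε * I) / Real.pi) *
      ((sinh (c * (x + ε * I)))⁻¹ * (x + ε * I : ℂ)⁻¹)) * (1 + exp (-(p / c))) = 1 := by
  have hc0 := ne_zero_of_re_ne_zero hc.ne'
  have hpi := Real.pi_pos
  have hpi0 : (Real.pi : ℂ) ≠ 0 := ofReal_ne_zero.2 Real.pi_ne_zero
  have ha := inv_re_pos hc
  have hne : ∀ x : ℝ, (x + ε * I : ℂ) ≠ 0 := fun x hz =>
    hε.ne' (by simpa using congrArg im hz)
  have hyε : |ε| < Real.pi * |(c⁻¹).re| := by rwa [abs_of_pos hε, abs_of_pos ha]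
  obtain ⟨C, hC⟩ := exists_norm_inv_sinh_line_le hc.ne' (y₁ := ε) (y₂ := ε)
    (fun y' hy' => by rw [Icc_self] at hy'; subst hy'; exact ⟨hε.ne', hyε⟩)
  have hw : ∀ x : ℝ, ‖(sinh (c * (x + ε * I)))⁻¹ * (x + ε * I : ℂ)⁻¹‖ ≤
      C * ε⁻¹ * Real.exp (-(c.re * |x|)) := by
    intro x
    have h1 := hC ε (by simp) x
    have h2 : ‖(x + ε * I : ℂ)⁻¹‖ ≤ ε⁻¹ := by
      rw [norm_inv]
      gcongr
      simpa [abs_of_pos hε] using abs_im_le_norm (x + ε * I : ℂ)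
    rw [abs_of_pos hc] at h1
    rw [norm_mul]
    calc _ ≤ C * Real.exp (-(c.re * |x|)) * ε⁻¹ :=
          mul_le_mul h1 h2 (norm_nonneg _) ((norm_nonneg _).trans h1)
      _ = _ := by ring
  have hm : Continuous fun x : ℝ => (sinh (c * (x + ε * I)))⁻¹ * (x + ε * I : ℂ)⁻¹ :=
    (continuous_inv_sinh_line hc.ne' hε.ne' hyε).mul (Continuous.inv₀ (by fun_prop) hne)
  set G : ℂ → ℂ := fun p => ∫ x : ℝ, exp (I * p * (x + ε * I) / Real.pi) *
      ((sinh (c * (x + ε * I)))⁻¹ * (x + ε * I : ℂ)⁻¹) with hG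
  have hGd : ∀ t : ℝ, ∃ G' : ℂ, HasDerivAt G G' (p + t) ∧
      (1 + exp ((p + t) / c)) * G' = 2 / c := by
    intro t
    have hpt : |(p + t : ℂ).im| < Real.pi * c.re := by simpa using hp
    refine ⟨_, hasDerivAt_integral_kernel_mul hm.aestronglyMeasurable hw hpt ε, ?_⟩
    have h1 := integral_kernel_mul_inv_sinh hc hpt hε hy
    have h2 : ∀ x : ℝ, (x + ε * I : ℂ) * ((sinh (c * (x + ε * I)))⁻¹ * (x + ε * I : ℂ)⁻¹) =
        (sinh (c * (x + ε * I)))⁻¹ := by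
      intro x
      rw [mul_comm, mul_assoc, inv_mul_cancel₀ (hne x), mul_one]
    simp only [h2]
    rw [integral_const_mul, mul_left_comm, h1]
    field_simp
    linear_combination -I_sq
  have hE : ∀ t : ℝ, HasDerivAt (fun t : ℝ => exp (1 / 2 * G (p + t)) *
      (1 + exp (-((p + t) / c)))) 0 t := by
    intro t
    obtain ⟨G', hG', hG''⟩ := hGd t
    have hexp : exp ((p + t) / c) * exp (-((p + t) / c)) = 1 := by
      rw [← Complex.exp_add, add_neg_cancel, exp_zero]
    have h1 : HasDerivAt (fun z : ℂ => exp (-(z / c)))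
        (exp (-((p + t) / c)) * (-(1 / c))) (p + t) :=
      ((hasDerivAt_id _).div_const c).neg.cexp
    have h2 := ((hG'.const_mul (1 / 2)).cexp.mul (h1.const_add 1))
    have h3 : HasDerivAt (fun z : ℂ => p + z) 1 (t : ℂ) := (hasDerivAt_id _).const_add p
    refine ((h2.comp (t : ℂ) h3).comp_ofReal).congr_deriv ?_
    linear_combination (exp (1 / 2 * G (p + t)) * exp (-((p + t) / c)) / 2) * hG'' -
      (exp (1 / 2 * G (p + t)) * G' / 2) * hexp
  have hconst : ∀ t : ℝ, exp (1 / 2 * G (p + t)) * (1 + exp (-((p + t) / c))) =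
      exp (1 / 2 * G p) * (1 + exp (-(p / c))) := by
    intro t
    have := is_const_of_deriv_eq_zero (fun t => (hE t).differentiableAt)
      (fun t => (hE t).deriv) t 0
    simpa using this
  refine tendsto_nhds_unique ((tendsto_const_nhds (x := _) (f := (atTop : Filter ℝ))).congr
    fun t => (hconst t).symm) ?_
  have hδ : 0 < c.re - |p.im| / Real.pi := by
    rw [sub_pos, div_lt_iff₀ Real.pi_pos]
    linarith
  have hGlim : Tendsto (fun t : ℝ => G (p + t)) atTop (𝓝 0) := by
    refine squeeze_zero_norm (fun t => norm_integral_kernel_mul_le hδ hw ?_ ε)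
      (a := fun t => _ * _) ?_
    · rw [sub_sub_cancel, mul_div_cancel₀ _ Real.pi_ne_zero]
      simp
    · have h1 : Tendsto (fun t : ℝ => (p + t : ℂ).re * ε / Real.pi) atTop atTop := by
        simp only [add_re, ofReal_re]
        exact ((tendsto_atTop_add_const_left _ _ tendsto_id).atTop_mul_const hε).atTop_div_const
          hpi
      have h2 := (Real.tendsto_exp_neg_atTop_nhds_zero.comp h1).mul_const
        (C * ε⁻¹ * ∫ x : ℝ, Real.exp (-((c.re - |p.im| / Real.pi) * |x|)))
      rw [zero_mul] at h2
      refine h2.congr fun t => ?_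
      simp only [Function.comp, neg_div]
  have hexplim : Tendsto (fun t : ℝ => exp (-((p + t) / c))) atTop (𝓝 0) := by
    rw [tendsto_zero_iff_norm_tendsto_zero]
    simp only [norm_exp, neg_re]
    refine Real.tendsto_exp_neg_atTop_nhds_zero.comp ?_
    have h1 : ∀ t : ℝ, ((p + t) / c).re = (p / c).re + t * (c⁻¹).re := by
      intro t
      rw [add_div, add_re, div_eq_mul_inv (t : ℂ), re_ofReal_mul]
    simp only [h1]
    exact tendsto_atTop_add_const_left _ _ (tendsto_id.atTop_mul_const ha)
  have := ((hGlim.const_mul (1 / 2)).cexp).mul (hexplim.const_add 1)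
  simpa using this

/-! ### Regularity of `ψ` -/

lemma psiIntegrand_eq (b p ξ : ℂ) : psiIntegrand b p ξ =
    exp (I * p * ξ / Real.pi) * ((sinh (b * ξ))⁻¹ * (sinh (b⁻¹ * ξ))⁻¹ * ξ⁻¹) := by
  rw [psiIntegrand, div_eq_mul_inv ξ b, mul_comm ξ b⁻¹]
  simp only [div_eq_mul_inv, mul_inv]
  ring

lemma AdmissibleHeight.re_ne_zero {b : ℂ} {ε : ℝ} (h : AdmissibleHeight b ε) : b.re ≠ 0 := by
  intro h0
  have := h.2.1
  rw [h0, abs_zero, mul_zero] at this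
  exact lt_asymm h.1 this

lemma AdmissibleHeight.abs_lt {b : ℂ} {ε : ℝ} (h : AdmissibleHeight b ε) :
    |ε| < Real.pi * |(b⁻¹).re| := by
  rw [abs_of_pos h.1]
  exact h.2.2

lemma AdmissibleHeight.abs_lt' {b : ℂ} {ε : ℝ} (h : AdmissibleHeight b ε) :
    |ε| < Real.pi * |((b⁻¹)⁻¹).re| := by
  rw [abs_of_pos h.1, inv_inv]
  exact h.2.1

lemma AdmissibleHeight.inv {b : ℂ} {ε : ℝ} (h : AdmissibleHeight b ε) :
    AdmissibleHeight b⁻¹ ε :=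
  ⟨h.1, h.2.2, by rw [inv_inv]; exact h.2.1⟩

lemma line_ne_zero {ε : ℝ} (hε : ε ≠ 0) (x : ℝ) : (x + ε * I : ℂ) ≠ 0 := fun hz =>
  hε (by simpa using congrArg im hz)

lemma AdmissibleHeight.continuous_weight {b : ℂ} {ε : ℝ} (h : AdmissibleHeight b ε) :
    Continuous fun x : ℝ => (sinh (b * (x + ε * I)))⁻¹ * (sinh (b⁻¹ * (x + ε * I)))⁻¹ *
      (x + ε * I : ℂ)⁻¹ :=
  ((continuous_inv_sinh_line h.re_ne_zero h.1.ne' h.abs_lt).mul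
    (continuous_inv_sinh_line (inv_re_ne_zero h.re_ne_zero) h.1.ne' h.abs_lt')).mul
    (Continuous.inv₀ (by fun_prop) (line_ne_zero h.1.ne'))

lemma norm_weight_le {s t : ℂ} {x y y₁ α β C D : ℝ} (h1 : 0 < y₁) (hy : y₁ ≤ y)
    (hs : ‖s‖ ≤ C * Real.exp (-(α * |x|))) (ht : ‖t‖ ≤ D * Real.exp (-(β * |x|))) :
    ‖s * t * (x + y * I : ℂ)⁻¹‖ ≤ C * D * y₁⁻¹ * Real.exp (-((α + β) * |x|)) := by
  have h2 : ‖(x + y * I : ℂ)⁻¹‖ ≤ y₁⁻¹ := by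
    rw [norm_inv]
    gcongr
    refine hy.trans ((le_abs_self y).trans ?_)
    simpa using abs_im_le_norm (x + y * I : ℂ)
  rw [norm_mul, norm_mul]
  have hs0 := (norm_nonneg _).trans hs
  have ht0 := (norm_nonneg _).trans ht
  calc _ ≤ C * Real.exp (-(α * |x|)) * (D * Real.exp (-(β * |x|))) * y₁⁻¹ :=
        mul_le_mul (mul_le_mul hs ht (norm_nonneg _) hs0) h2 (norm_nonneg _) (mul_nonneg hs0 ht0)
    _ = C * D * y₁⁻¹ * Real.exp (-(α * |x|) + -(β * |x|)) := by rw [Real.exp_add]; ring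
    _ = _ := by ring_nf

lemma exists_norm_weight_le {b : ℂ} {y₁ y₂ : ℝ} (hb : b.re ≠ 0)
    (h : ∀ y ∈ Icc y₁ y₂, AdmissibleHeight b y) (h1 : 0 < y₁) :
    ∃ C, ∀ y ∈ Icc y₁ y₂, ∀ x : ℝ, ‖(sinh (b * (x + y * I)))⁻¹ * (sinh (b⁻¹ * (x + y * I)))⁻¹ *
      (x + y * I : ℂ)⁻¹‖ ≤ C * Real.exp (-((|b.re| + |(b⁻¹).re|) * |x|)) := by
  obtain ⟨C, hC⟩ := exists_norm_inv_sinh_line_le hb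
    (fun y hy => ⟨(h y hy).1.ne', (h y hy).abs_lt⟩)
  obtain ⟨D, hD⟩ := exists_norm_inv_sinh_line_le (inv_re_ne_zero hb)
    (fun y hy => ⟨(h y hy).1.ne', (h y hy).abs_lt'⟩)
  exact ⟨C * D * y₁⁻¹, fun y hy x => norm_weight_le h1 hy.1 (hC y hy x) (hD y hy x)⟩

lemma AdmissibleHeight.exists_norm_weight_le {b : ℂ} {ε : ℝ} (h : AdmissibleHeight b ε) :
    ∃ C, ∀ x : ℝ, ‖(sinh (b * (x + ε * I)))⁻¹ * (sinh (b⁻¹ * (x + ε * I)))⁻¹ *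
      (x + ε * I : ℂ)⁻¹‖ ≤ C * Real.exp (-((|b.re| + |(b⁻¹).re|) * |x|)) := by
  obtain ⟨C, hC⟩ := ModularDouble.exists_norm_weight_le (y₁ := ε) (y₂ := ε) h.re_ne_zero
    (fun y hy => by rw [Icc_self] at hy; subst hy; exact h) h.1
  exact ⟨C, hC ε (by simp)⟩

lemma exists_admissibleHeight {b : ℂ} (hb : b.re ≠ 0) : ∃ ε : ℝ, AdmissibleHeight b ε := by
  have h1 : 0 < Real.pi * |b.re| := mul_pos Real.pi_pos (abs_pos.2 hb)
  have h2 : 0 < Real.pi * |(b⁻¹).re| := mul_pos Real.pi_pos (abs_pos.2 (inv_re_ne_zero hb))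
  obtain ⟨ε, h0, h3⟩ := exists_between (lt_min h1 h2)
  exact ⟨ε, h0, h3.trans_le (min_le_left _ _), h3.trans_le (min_le_right _ _)⟩

lemma integrable_psiIntegrand {b p : ℂ} {ε : ℝ} (h : AdmissibleHeight b ε) (hp : InStrip b p) :
    Integrable fun x : ℝ => psiIntegrand b p (x + ε * I) := by
  simp only [psiIntegrand_eq]
  obtain ⟨C, hC⟩ := h.exists_norm_weight_le
  exact integrable_kernel_mul h.continuous_weight.aestronglyMeasurable hC hp ε

lemma psi_eq_of_le {b p : ℂ} {ε ε' : ℝ} (h : AdmissibleHeight b ε) (h' : AdmissibleHeight b ε')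
    (hle : ε ≤ ε') (hp : InStrip b p) : psi b ε p = psi b ε' p := by
  have hb := h.re_ne_zero
  have hb0 := ne_zero_of_re_ne_zero hb
  have hband : ∀ y ∈ Icc ε ε', AdmissibleHeight b y := fun y hy =>
    ⟨h.1.trans_le hy.1, hy.2.trans_lt h'.2.1, hy.2.trans_lt h'.2.2⟩
  obtain ⟨C, hC⟩ := exists_norm_weight_le hb hband h.1
  simp only [psi, psiIntegrand_eq]
  rw [integral_kernel_mul_eq
    (W := fun z => (sinh (b * z))⁻¹ * (sinh (b⁻¹ * z))⁻¹ * z⁻¹) hle (fun z hz => ?_) hC hp]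
  have hz0 : z ≠ 0 := fun h0 => (hband _ hz).1.ne' (by simp [h0])
  refine ((DifferentiableAt.inv (by fun_prop) fun h0 => hz0 ?_).mul
    (DifferentiableAt.inv (by fun_prop) fun h0 => hz0 ?_)).mul (differentiableAt_inv hz0)
  · exact eq_zero_of_sinh_eq_zero hb0 (hband _ hz).abs_lt h0
  · exact eq_zero_of_sinh_eq_zero (inv_ne_zero hb0) (hband _ hz).abs_lt' h0

lemma psi_eq_of_admissibleHeight {b p : ℂ} {ε ε' : ℝ} (h : AdmissibleHeight b ε)
    (h' : AdmissibleHeight b ε') (hp : InStrip b p) : psi b ε p = psi b ε' p := by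
  rcases le_total ε ε' with hle | hle
  · exact psi_eq_of_le h h' hle hp
  · exact (psi_eq_of_le h' h hle hp).symm

lemma differentiableAt_psi {b p : ℂ} {ε : ℝ} (h : AdmissibleHeight b ε) (hp : InStrip b p) :
    DifferentiableAt ℂ (psi b ε) p := by
  obtain ⟨C, hC⟩ := h.exists_norm_weight_le
  have h1 := hasDerivAt_integral_kernel_mul h.continuous_weight.aestronglyMeasurable hC hp ε
  unfold psi
  simp only [psiIntegrand_eq]
  exact (h1.differentiableAt.const_mul (1 / 4)).cexp

lemma psi_inv (b : ℂ) : psi b⁻¹ = psi b := by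
  funext ε p
  simp only [psi, psiIntegrand_eq, inv_inv, mul_comm (sinh (b⁻¹ * _))⁻¹]

lemma psi_neg (b : ℂ) : psi (-b) = psi b := by
  funext ε p
  simp only [psi, psiIntegrand_eq, inv_neg, neg_mul, sinh_neg, mul_neg, neg_neg]

lemma eventually_exists_norm_inv_sinh_le {c₀ : ℂ} {y : ℝ} (hc : c₀.re ≠ 0) (h0 : y ≠ 0)
    (hy : |y| < Real.pi * |(c₀⁻¹).re|) :
    ∃ C, ∀ᶠ c in 𝓝 c₀, ∀ x : ℝ,
      ‖(sinh (c * (x + y * I)))⁻¹‖ ≤ C * Real.exp (-(|c.re| * |x|)) := by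
  have hU : {c : ℂ | c.re ≠ 0 ∧ |y| < Real.pi * |(c⁻¹).re|} ∈ 𝓝 c₀ := by
    have hinv : ContinuousAt (fun c : ℂ => Real.pi * |(c⁻¹).re|) c₀ :=
      ((continuous_re.continuousAt.comp
        (continuousAt_inv₀ (ne_zero_of_re_ne_zero hc))).abs).const_mul _
    exact (continuous_re.continuousAt.eventually_ne hc).and
      (continuousAt_const.eventually_lt hinv hy)
  obtain ⟨K, hK, hKU, hKc⟩ := local_compact_nhds hU
  obtain ⟨C, hC⟩ := exists_norm_inv_sinh_le (K := K ×ˢ {y}) (hKc.prod isCompact_singleton)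
    (fun k hk => (hKU hk.1).1)
    (by
      rintro ⟨c, y'⟩ ⟨hk, rfl⟩
      exact sinh_line_ne_zero (ne_zero_of_re_ne_zero (hKU hk).1) h0 (hKU hk).2)
  exact ⟨C, eventually_of_mem hK fun c hc x => hC (c, y) ⟨hc, rfl⟩ x⟩

lemma continuousAt_psi {b₀ p₀ : ℂ} {ε : ℝ} (h : AdmissibleHeight b₀ ε) (hp : InStrip b₀ p₀) :
    ContinuousAt (fun z : ℂ × ℂ => psi z.1 ε z.2) (b₀, p₀) := by
  have hb := h.re_ne_zero
  have hb0 := ne_zero_of_re_ne_zero hb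
  have hinv : ContinuousAt (fun b : ℂ => b⁻¹) b₀ := continuousAt_inv₀ hb0
  obtain ⟨C, hC⟩ := eventually_exists_norm_inv_sinh_le hb h.1.ne' h.abs_lt
  obtain ⟨D, hD⟩ := eventually_exists_norm_inv_sinh_le (inv_re_ne_zero hb) h.1.ne' h.abs_lt'
  have hadm : ∀ᶠ b in 𝓝 b₀, AdmissibleHeight b ε := by
    have h1 : ContinuousAt (fun b : ℂ => Real.pi * |b.re|) b₀ := by fun_prop
    have h2 : ContinuousAt (fun b : ℂ => Real.pi * |(b⁻¹).re|) b₀ :=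
      ((continuous_re.continuousAt.comp hinv).abs).const_mul _
    filter_upwards [continuousAt_const.eventually_lt h1 h.2.1,
      continuousAt_const.eventually_lt h2 h.2.2] with b hb1 hb2
    exact ⟨h.1, hb1, hb2⟩
  -- The decay rate varies with b; a fixed margin δ survives small perturbations of (b, p) and gives
  -- one dominating function.
  obtain ⟨δ, hδ, hpδ⟩ : ∃ δ > 0, |p₀.im| < Real.pi * ((|b₀.re| + |(b₀⁻¹).re|) - δ) := by
    refine ⟨((|b₀.re| + |(b₀⁻¹).re|) - |p₀.im| / Real.pi) / 2, ?_, ?_⟩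
    · have : |p₀.im| / Real.pi < |b₀.re| + |(b₀⁻¹).re| := by
        rw [div_lt_iff₀ Real.pi_pos, mul_comm]
        exact hp
      linarith
    · have h1 : Real.pi * (|p₀.im| / Real.pi) = |p₀.im| := mul_div_cancel₀ _ Real.pi_ne_zero
      have h2 : |p₀.im| < Real.pi * (|b₀.re| + |(b₀⁻¹).re|) := hp
      linarith
  have hfst : ContinuousAt (fun z : ℂ × ℂ => z.1) (b₀, p₀) := continuousAt_fst
  have hinv' : ContinuousAt (fun z : ℂ × ℂ => z.1⁻¹) (b₀, p₀) := hfst.inv₀ hb0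
  have hstrip : ∀ᶠ z : ℂ × ℂ in 𝓝 (b₀, p₀),
      |z.2.im| < Real.pi * ((|z.1.re| + |(z.1⁻¹).re|) - δ) := by
    have h1 : ContinuousAt (fun z : ℂ × ℂ => |z.2.im|) (b₀, p₀) := by fun_prop
    have h2 : ContinuousAt (fun z : ℂ × ℂ => |z.1.re|) (b₀, p₀) := by fun_prop
    have h3 : ContinuousAt (fun z : ℂ × ℂ => |(z.1⁻¹).re|) (b₀, p₀) :=
      (continuous_re.continuousAt.comp hinv').abs
    exact h1.eventually_lt (((h2.add h3).sub continuousAt_const).const_mul _) hpδ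
  have hheight : ∀ᶠ z : ℂ × ℂ in 𝓝 (b₀, p₀), -(z.2.re * ε) < -(p₀.re * ε) + 1 := by
    have h1 : ContinuousAt (fun z : ℂ × ℂ => -(z.2.re * ε)) (b₀, p₀) := by fun_prop
    exact h1.eventually_lt continuousAt_const (by simp)
  simp only [psi, psiIntegrand_eq]
  refine ContinuousAt.cexp (ContinuousAt.const_mul ?_ _)
  refine continuousAt_of_dominated (bound := fun x =>
    Real.exp ((-(p₀.re * ε) + 1) / Real.pi) * (C * D * ε⁻¹) * Real.exp (-(δ * |x|))) ?_ ?_ ?_ ?_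
  · filter_upwards [hfst.eventually hadm] with z hz
    exact (Continuous.mul (by fun_prop) hz.continuous_weight).aestronglyMeasurable
  · filter_upwards [hfst.eventually hC, hinv'.eventually hD, hstrip, hheight] with z h1 h2 h3 h4
    refine Eventually.of_forall fun x => ?_
    exact norm_kernel_mul_le h3.le h4.le (norm_weight_le h.1 le_rfl (h1 x) (h2 x))
  · exact (integrable_exp_neg_mul_abs hδ).const_mul _
  · refine Eventually.of_forall fun x => ContinuousAt.mul (by fun_prop) ?_
    refine ContinuousAt.mul (ContinuousAt.mul ?_ ?_) continuousAt_const
    · exact ContinuousAt.inv₀ (by fun_prop)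
        (sinh_line_ne_zero hb0 h.1.ne' h.abs_lt x)
    · refine ContinuousAt.inv₀ ?_ (sinh_line_ne_zero (inv_ne_zero hb0) h.1.ne' h.abs_lt' x)
      exact (continuous_sinh.continuousAt).comp (hinv'.mul continuousAt_const)

/-! ### The difference equations of `ψ` -/

/-- The two shifts differ by the factor e^{bξ} - e^{-bξ} = 2 sinh(bξ), which cancels a denominator.
The bound on Im p keeps both shifted points in the strip. -/
lemma psi_sub_mul {b p : ℂ} {ε : ℝ} (hb : 0 < b.re) (h : AdmissibleHeight b ε)
    (hp : |p.im| < Real.pi * (b⁻¹).re) :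
    psi b ε (p - Real.pi * I * b) * (1 + exp (-(b * p))) = psi b ε (p + Real.pi * I * b) := by
  have hb0 := ne_zero_of_re_ne_zero hb.ne'
  have hpi := Real.pi_pos
  have hpi0 : (Real.pi : ℂ) ≠ 0 := ofReal_ne_zero.2 Real.pi_ne_zero
  have ha := inv_re_pos hb
  obtain ⟨h1, h2⟩ := abs_lt.1 hp
  have hbpi := mul_pos hpi hb
  have hs1 : InStrip b (p - Real.pi * I * b) := by
    rw [InStrip, abs_of_pos hb, abs_of_pos ha, _root_.abs_lt]
    simp only [sub_im, mul_im, mul_re, ofReal_re, ofReal_im, I_re, I_im]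
    constructor <;> linarith
  have hs2 : InStrip b (p + Real.pi * I * b) := by
    rw [InStrip, abs_of_pos hb, abs_of_pos ha, _root_.abs_lt]
    simp only [add_im, mul_im, mul_re, ofReal_re, ofReal_im, I_re, I_im]
    constructor <;> linarith
  have hfac := exp_integral_kernel_div_mul ha h.1
    (by rw [inv_inv]; simpa [abs_of_pos hb] using h.2.1) hp
  have hdiff : (∫ x : ℝ, psiIntegrand b (p - Real.pi * I * b) (x + ε * I)) -
      ∫ x : ℝ, psiIntegrand b (p + Real.pi * I * b) (x + ε * I) =
      2 * ∫ x : ℝ, exp (I * p * (x + ε * I) / Real.pi) *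
        ((sinh (b⁻¹ * (x + ε * I)))⁻¹ * (x + ε * I : ℂ)⁻¹) := by
    rw [← integral_sub (integrable_psiIntegrand h hs1) (integrable_psiIntegrand h hs2),
      ← integral_const_mul]
    congr 1
    funext x
    rw [psiIntegrand_eq, psiIntegrand_eq]
    generalize hξ : (x + ε * I : ℂ) = ξ
    have hne : sinh (b * ξ) ≠ 0 := by
      rw [← hξ]
      exact sinh_line_ne_zero hb0 h.1.ne' h.abs_lt x
    have e1 : I * (p - Real.pi * I * b) * ξ / Real.pi = I * p * ξ / Real.pi + b * ξ := by
      field_simp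
      linear_combination (-Real.pi * b * ξ : ℂ) * I_sq
    have e2 : I * (p + Real.pi * I * b) * ξ / Real.pi = I * p * ξ / Real.pi + -(b * ξ) := by
      field_simp
      linear_combination (Real.pi * b * ξ : ℂ) * I_sq
    have e3 : exp (b * ξ) = exp (-(b * ξ)) + 2 * sinh (b * ξ) := by
      rw [sinh]
      ring
    rw [e1, e2, Complex.exp_add, Complex.exp_add, e3]
    linear_combination (2 * exp (I * p * ξ / Real.pi) * (sinh (b⁻¹ * ξ))⁻¹ * ξ⁻¹) *
      mul_inv_cancel₀ hne
  have hquot : psi b ε (p - Real.pi * I * b) = psi b ε (p + Real.pi * I * b) *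
      exp (1 / 2 * ∫ x : ℝ, exp (I * p * (x + ε * I) / Real.pi) *
        ((sinh (b⁻¹ * (x + ε * I)))⁻¹ * (x + ε * I : ℂ)⁻¹)) := by
    rw [psi, psi, ← Complex.exp_add]
    congr 1
    linear_combination (1 / 4) * hdiff
  rw [div_inv_eq_mul, mul_comm p b] at hfac
  rw [hquot, mul_assoc, hfac, mul_one]

/-! ### Functions with two periods on a strip -/

/-- A function on the strip `|Im p| < A + B` that is invariant under the two translations `ω₁`
(down) and `ω₂` (up), both of which move to the right, is determined by its behaviour at the right
end of the strip, on every horizontal line whose orbit avoids the height `A - B`. -/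
lemma eq_one_of_two_periods {Q : ℂ → ℂ} {A B : ℝ} {ω₁ ω₂ : ℂ} (hA : 0 < A) (hB : 0 < B)
    (him₁ : ω₁.im = -(2 * A)) (hre₁ : 0 < ω₁.re) (him₂ : ω₂.im = 2 * B) (hre₂ : 0 < ω₂.re)
    (h₁ : ∀ p : ℂ, A - B < p.im → p.im < A + B → Q (p + ω₁) = Q p)
    (h₂ : ∀ p : ℂ, -(A + B) < p.im → p.im < A - B → Q (p + ω₂) = Q p)
    (hlim : ∀ r : ℕ → ℂ, (∀ n, |(r n).im| ≤ A + B - min A B) →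
      Tendsto (fun n => (r n).re) atTop atTop → Tendsto (fun n => Q (r n)) atTop (𝓝 1))
    {p : ℂ} (hp : |p.im| < A + B)
    (hgen : ∀ m n : ℤ, p.im + 2 * A * m + 2 * B * n ≠ A - B) : Q p = 1 := by
  have hδA := min_le_left A B
  have hδB := min_le_right A B
  have hδ := lt_min hA hB
  set δ := min A B
  set ρ := min ω₁.re ω₂.re
  have hρ₁ : ρ ≤ ω₁.re := min_le_left _ _
  have hρ₂ : ρ ≤ ω₂.re := min_le_right _ _
  have hρ : 0 < ρ := lt_min hre₁ hre₂
  -- Make n moves, each gaining at least ρ in real part, then at most one more to reach the closed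
  -- substrip where the limit is available. The condition on heights is stated for the whole lattice
  -- so that every move preserves it.
  have key : ∀ n : ℕ, ∀ p : ℂ, |p.im| < A + B →
      (∀ m k : ℤ, p.im + 2 * A * m + 2 * B * k ≠ A - B) →
      ∃ r : ℂ, |r.im| ≤ A + B - δ ∧ p.re + n * ρ ≤ r.re ∧ Q r = Q p := by
    intro n
    induction n with
    | zero =>
      intro p hp _
      obtain ⟨hp1, hp2⟩ := abs_lt.1 hp
      by_cases hup : A + B - δ < p.im
      · refine ⟨p + ω₁, ?_, ?_, h₁ p (by linarith) hp2⟩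
        · rw [abs_le, add_im, him₁]
          constructor <;> linarith
        · simp only [add_re, Nat.cast_zero]
          linarith
      by_cases hdown : p.im < -(A + B - δ)
      · refine ⟨p + ω₂, ?_, ?_, h₂ p hp1 (by linarith)⟩
        · rw [abs_le, add_im, him₂]
          constructor <;> linarith
        · simp only [add_re, Nat.cast_zero]
          linarith
      exact ⟨p, abs_le.2 ⟨not_lt.1 hdown, not_lt.1 hup⟩, by simp, rfl⟩
    | succ n ih =>
      intro p hp hg
      obtain ⟨hp1, hp2⟩ := abs_lt.1 hp
      -- At height A - B both moves would land exactly on the boundary of the strip; at any other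
      -- height one of them stays inside.
      have hne : p.im ≠ A - B := by simpa using hg 0 0
      rcases lt_or_gt_of_ne hne with hlt | hgt
      · obtain ⟨r, hr1, hr2, hr3⟩ := ih (p + ω₂)
          (by rw [abs_lt, add_im, him₂]; constructor <;> linarith)
          (fun m k hmk => hg m (k + 1) (by
            rw [← hmk, add_im, him₂]; push_cast; ring))
        refine ⟨r, hr1, ?_, hr3.trans (h₂ p hp1 hlt)⟩
        rw [add_re] at hr2
        push_cast
        linarith
      · obtain ⟨r, hr1, hr2, hr3⟩ := ih (p + ω₁)
          (by rw [abs_lt, add_im, him₁]; constructor <;> linarith)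
          (fun m k hmk => hg (m - 1) k (by
            rw [← hmk, add_im, him₁]; push_cast; ring))
        refine ⟨r, hr1, ?_, hr3.trans (h₁ p hgt hp2)⟩
        rw [add_re] at hr2
        push_cast
        linarith
  choose r hr1 hr2 hr3 using fun n => key n p hp hgen
  have h := hlim r hr1 (tendsto_atTop_mono hr2
    (tendsto_atTop_add_const_left _ _ (tendsto_natCast_atTop_atTop.atTop_mul_const hρ)))
  simp only [hr3] at h
  exact tendsto_nhds_unique tendsto_const_nhds h

/-- Approach p along a vertical line: the complement of a countable set of heights is dense. -/
lemma eq_of_forall_not_mem_countable {F H : ℂ → ℂ} {T : Set ℝ} (hT : T.Countable) {p : ℂ}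
    (hF : ContinuousAt F p) (hH : ContinuousAt H p)
    (h : ∀ᶠ z in 𝓝 p, z.im ∉ T → F z = H z) : F p = H p := by
  have hpath : Tendsto (fun s : ℝ => p + (s - p.im : ℝ) * I) (𝓝 p.im) (𝓝 p) := by
    have : Continuous fun s : ℝ => p + (s - p.im : ℝ) * I := by fun_prop
    simpa using this.tendsto p.im
  by_contra hne
  have h1 : ∀ᶠ z in 𝓝 p, F z ≠ H z := hF.ne_iff_eventually_ne hH |>.1 hne
  have h2 : ∃ᶠ s in 𝓝 p.im, s ∈ Tᶜ := mem_closure_iff_frequently.1 (hT.dense_compl ℝ p.im)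
  obtain ⟨s, hs, hs1, hs2⟩ :=
    (h2.and_eventually ((hpath.eventually h1).and (hpath.eventually h))).exists
  exact hs1 (hs2 (by simpa using hs))

/-! ### The factorization of `ψ` -/

lemma norm_qParam_lt_one {b : ℂ} (hb : 0 < (b ^ 2).im) : ‖qParam b‖ < 1 := by
  rw [qParam, norm_exp, Real.exp_lt_one_iff]
  have : (I * Real.pi * b ^ 2).re = -(Real.pi * (b ^ 2).im) := by
    simp only [mul_re, mul_im, I_re, I_im, ofReal_re, ofReal_im]
    ring
  rw [this, neg_lt_zero]
  exact mul_pos Real.pi_pos hb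

lemma norm_qDual_lt_one {b : ℂ} (hb : 0 < (b ^ 2).im) : ‖qDual b‖ < 1 := by
  rw [qDual, norm_exp, Real.exp_lt_one_iff]
  have h0 : b ^ 2 ≠ 0 := fun h => hb.ne' (by simp [h])
  have : (-(I * Real.pi) / b ^ 2).re = -(Real.pi * ((b ^ 2).im / normSq (b ^ 2))) := by
    rw [div_eq_mul_inv]
    simp only [mul_re, mul_im, I_re, I_im, ofReal_re, ofReal_im, neg_re, neg_im, inv_im]
    ring
  rw [this, neg_lt_zero]
  exact mul_pos Real.pi_pos (div_pos hb (normSq_pos.2 h0))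

lemma im_pos_of_im_sq_pos {b : ℂ} (hb : 0 < b.re) (hb2 : 0 < (b ^ 2).im) : 0 < b.im := by
  have : (b ^ 2).im = 2 * b.re * b.im := by
    rw [sq, mul_im]
    ring
  rw [this] at hb2
  exact pos_of_mul_pos_right hb2 (by positivity)

lemma tendsto_psi_comp {b : ℂ} {ε δ : ℝ} (h : AdmissibleHeight b ε) (hδ : 0 < δ) {r : ℕ → ℂ}
    (him : ∀ n, |(r n).im| ≤ Real.pi * ((|b.re| + |(b⁻¹).re|) - δ))
    (hre : Tendsto (fun n => (r n).re) atTop atTop) :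
    Tendsto (fun n => psi b ε (r n)) atTop (𝓝 1) := by
  obtain ⟨C, hC⟩ := h.exists_norm_weight_le
  have hint : Tendsto (fun n => ∫ x : ℝ, psiIntegrand b (r n) (x + ε * I)) atTop (𝓝 0) := by
    simp only [psiIntegrand_eq]
    refine squeeze_zero_norm (fun n => norm_integral_kernel_mul_le hδ hC (him n) ε)
      (a := fun n => _ * _) ?_
    have h1 : Tendsto (fun n => (r n).re * ε / Real.pi) atTop atTop :=
      (hre.atTop_mul_const h.1).atTop_div_const Real.pi_pos
    have h2 := (Real.tendsto_exp_neg_atTop_nhds_zero.comp h1).mul_const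
      (C * ∫ x : ℝ, Real.exp (-(δ * |x|)))
    rw [zero_mul] at h2
    refine h2.congr fun n => ?_
    simp only [Function.comp, neg_div]
  have := (hint.const_mul (1 / 4)).cexp
  rwa [mul_zero, exp_zero] at this

lemma tendsto_exp_neg_mul {a : ℂ} (ha : 0 < a.re) {r : ℕ → ℂ} {M : ℝ}
    (him : ∀ n, |(r n).im| ≤ M) (hre : Tendsto (fun n => (r n).re) atTop atTop) :
    Tendsto (fun n => exp (-(a * r n))) atTop (𝓝 0) := by
  rw [tendsto_zero_iff_norm_tendsto_zero]
  simp only [norm_exp, neg_re]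
  refine Real.tendsto_exp_neg_atTop_nhds_zero.comp ?_
  refine tendsto_atTop_mono (fun n => ?_)
    (tendsto_atTop_add_const_right _ (-(|a.im| * M)) (hre.const_mul_atTop ha))
  rw [mul_re]
  have h1 : a.im * (r n).im ≤ |a.im| * |(r n).im| := by
    rw [← abs_mul]
    exact le_abs_self _
  have h2 := mul_le_mul_of_nonneg_left (him n) (abs_nonneg a.im)
  linarith

lemma exp_neg_sub_pi_mul_I (z : ℂ) : exp (-(z - Real.pi * I)) = exp (-(z + Real.pi * I)) := by
  rw [exp_eq_exp_iff_exists_int]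
  exact ⟨1, by push_cast; ring⟩

lemma psi_mul_qExp_eq {b p : ℂ} {ε : ℝ} (hb : 0 < b.re) (hb2 : 0 < (b ^ 2).im)
    (h : AdmissibleHeight b ε) (hp : InStrip b p) :
    psi b ε p * qExp (qDual b) (exp (-(p / b))) = qExp (qParam b) (exp (-(b * p))) := by
  have hb0 := ne_zero_of_re_ne_zero hb.ne'
  have hpi := Real.pi_pos
  have ha := inv_re_pos hb
  have hbim := im_pos_of_im_sq_pos hb hb2
  have haim : (b⁻¹).im < 0 := by
    rw [inv_im]
    exact div_neg_of_neg_of_pos (neg_lt_zero.2 hbim) (normSq_pos.2 hb0)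
  have hq := norm_qParam_lt_one hb2
  have hq' := norm_qDual_lt_one hb2
  have hA := mul_pos hpi hb
  have hB := mul_pos hpi ha
  have hstrip : ∀ z : ℂ, InStrip b z ↔ |z.im| < Real.pi * b.re + Real.pi * (b⁻¹).re := by
    intro z
    rw [InStrip, abs_of_pos hb, abs_of_pos ha, mul_add]
  set N : ℂ → ℂ := fun z => qExp (qParam b) (exp (-(b * z))) with hN
  set D : ℂ → ℂ := fun z => qExp (qDual b) (exp (-(z / b))) with hD
  have hNc : Continuous N := (continuous_qExp hq).comp (by fun_prop)
  have hDc : Continuous D := (continuous_qExp hq').comp (by fun_prop)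
  have hNb : ∀ z, N (z + Real.pi * I * b) = (1 + exp (-(b * z))) * N (z - Real.pi * I * b) := by
    intro z
    have e1 : exp (-(b * (z + Real.pi * I * b))) = (qParam b)⁻¹ * exp (-(b * z)) := by
      rw [qParam, ← Complex.exp_neg, ← Complex.exp_add]
      ring_nf
    have e2 : exp (-(b * (z - Real.pi * I * b))) = qParam b * exp (-(b * z)) := by
      rw [qParam, ← Complex.exp_add]
      ring_nf
    simp only [hN, e1, e2]
    exact qExp_inv_mul hq (exp_ne_zero _) _
  have hNa : ∀ z, N (z + Real.pi * I * b⁻¹) = N (z - Real.pi * I * b⁻¹) := by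
    intro z
    have e1 : b * (z + Real.pi * I * b⁻¹) = b * z + Real.pi * I := by field_simp
    have e2 : b * (z - Real.pi * I * b⁻¹) = b * z - Real.pi * I := by field_simp
    simp only [hN, e1, e2, exp_neg_sub_pi_mul_I]
  have hDa : ∀ z, D (z - Real.pi * I * b⁻¹) = (1 + exp (-(z / b))) * D (z + Real.pi * I * b⁻¹) := by
    intro z
    have e1 : exp (-((z - Real.pi * I * b⁻¹) / b)) = (qDual b)⁻¹ * exp (-(z / b)) := by
      rw [qDual, ← Complex.exp_neg, ← Complex.exp_add]
      congr 1
      field_simp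
      ring
    have e2 : exp (-((z + Real.pi * I * b⁻¹) / b)) = qDual b * exp (-(z / b)) := by
      rw [qDual, ← Complex.exp_add]
      congr 1
      field_simp
      ring
    simp only [hD, e1, e2]
    exact qExp_inv_mul hq' (exp_ne_zero _) _
  have hDb : ∀ z, D (z + Real.pi * I * b) = D (z - Real.pi * I * b) := by
    intro z
    have e1 : (z + Real.pi * I * b) / b = z / b + Real.pi * I := by field_simp
    have e2 : (z - Real.pi * I * b) / b = z / b - Real.pi * I := by field_simp
    simp only [hD, e1, e2, exp_neg_sub_pi_mul_I]
  set Q : ℂ → ℂ := fun z => psi b ε z * D z / N z with hQ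
  have hQb : ∀ z : ℂ, |z.im| < Real.pi * (b⁻¹).re →
      Q (z - Real.pi * I * b) = Q (z + Real.pi * I * b) := by
    intro z hz
    have h1 := psi_sub_mul hb h hz
    -- ψ is an exponential and never vanishes, so the difference equation itself excludes zeros of
    -- this factor.
    have h2 : 1 + exp (-(b * z)) ≠ 0 := by
      intro h0
      rw [h0, mul_zero] at h1
      exact exp_ne_zero _ h1.symm
    simp only [hQ]
    rw [hNb, hDb, ← h1, mul_right_comm (psi b ε _), mul_comm (1 + exp (-(b * z))),
      mul_div_mul_right _ _ h2]
  have hQa : ∀ z : ℂ, |z.im| < Real.pi * b.re →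
      Q (z - Real.pi * I * b⁻¹) = Q (z + Real.pi * I * b⁻¹) := by
    intro z hz
    have h1 := psi_sub_mul ha h.inv (by rwa [inv_inv])
    rw [psi_inv, mul_comm b⁻¹ z, ← div_eq_mul_inv z] at h1
    simp only [hQ]
    rw [hNa, hDa, ← h1, mul_assoc (psi b ε _)]
  have hgen : ∀ z : ℂ, InStrip b z →
      (∀ m n : ℤ, z.im + 2 * (Real.pi * b.re) * m + 2 * (Real.pi * (b⁻¹).re) * n ≠
        Real.pi * b.re - Real.pi * (b⁻¹).re) → psi b ε z * D z = N z := by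
    intro z hz hg
    -- Possible zeros of `N` do no harm: division by zero gives `Q` the value 0, and the periodicity
    -- still holds. Thus `Q z = 1` also proves `N z ≠ 0`. The periods move right because Im b > 0
    -- and Im(1/b) < 0.
    have hone : Q z = 1 := by
      refine eq_one_of_two_periods (ω₁ := -(2 * Real.pi * I * b)) (ω₂ := 2 * Real.pi * I * b⁻¹)
        hA hB ?_ ?_ ?_ ?_ (fun w hw1 hw2 => ?_) (fun w hw1 hw2 => ?_) (fun r hr hre => ?_)
        ((hstrip z).1 hz) hg
      · simp
        ring
      · simp
        positivity
      · simp
        ring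
      · have h1 : (2 * Real.pi * I * b⁻¹).re = 2 * Real.pi * -(b⁻¹).im := by simp
        rw [h1]
        have := neg_pos.2 haim
        positivity
      · have h1 := hQb (w - Real.pi * I * b) (by
          rw [_root_.abs_lt]
          simp only [sub_im, mul_im, mul_re, ofReal_re, ofReal_im, I_re, I_im]
          constructor <;> linarith)
        rw [sub_add_cancel] at h1
        rw [← h1]
        ring_nf
      · have h1 := hQa (w + Real.pi * I * b⁻¹) (by
          rw [_root_.abs_lt]
          simp only [add_im, mul_im, mul_re, ofReal_re, ofReal_im, I_re, I_im]
          constructor <;> linarith)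
        rw [add_sub_cancel_right] at h1
        rw [h1]
        ring_nf
      · have hδ : 0 < min (Real.pi * b.re) (Real.pi * (b⁻¹).re) / Real.pi :=
          div_pos (lt_min hA hB) hpi
        have hpsi := tendsto_psi_comp h hδ (r := r) (fun n => (hr n).trans_eq (by
          rw [abs_of_pos hb, abs_of_pos ha, mul_sub, mul_div_cancel₀ _ hpi.ne', mul_add])) hre
        have hNl : Tendsto (fun n => N (r n)) atTop (𝓝 1) := by
          have := ((continuous_qExp hq).tendsto 0).comp (tendsto_exp_neg_mul hb hr hre)
          rwa [qExp_zero] at this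
        have hDl : Tendsto (fun n => D (r n)) atTop (𝓝 1) := by
          have := ((continuous_qExp hq').tendsto 0).comp (tendsto_exp_neg_mul ha hr hre)
          rw [qExp_zero] at this
          refine this.congr fun n => ?_
          simp only [hD, Function.comp, div_eq_mul_inv, mul_comm b⁻¹]
        have := (hpsi.mul hDl).div hNl one_ne_zero
        rwa [mul_one, div_one] at this
    have hN0 : N z ≠ 0 := by
      intro h0
      simp [hQ, h0] at hone
    exact (div_eq_one_iff_eq hN0).1 hone
  refine eq_of_forall_not_mem_countable (F := fun z => psi b ε z * D z) (H := N)
    (T := range fun mn : ℤ × ℤ => Real.pi * b.re - Real.pi * (b⁻¹).re -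
      2 * (Real.pi * b.re) * mn.1 - 2 * (Real.pi * (b⁻¹).re) * mn.2) (countable_range _)
    ((differentiableAt_psi h hp).continuousAt.mul hDc.continuousAt) hNc.continuousAt ?_
  have hev : ∀ᶠ z : ℂ in 𝓝 p, InStrip b z :=
    (continuous_im.abs.continuousAt).eventually_lt continuousAt_const hp
  filter_upwards [hev] with z hz hzT
  exact hgen z hz fun m n hmn => hzT ⟨(m, n), by simp only; linarith⟩

end ModularDouble

end

theorem mainTheorem2 :
    -- the factorization, for `Im b² > 0`
    (∀ (b : ℂ) (ε : ℝ) (p : ℂ), 0 < (b ^ 2).im →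
      ModularDouble.AdmissibleHeight b ε → ModularDouble.InStrip b p →
      (‖ModularDouble.qParam b‖ < 1 ∧ ‖ModularDouble.qDual b‖ < 1) ∧
      Multipliable (fun n : ℕ =>
        1 + ModularDouble.qParam b ^ (2 * n + 1) * Complex.exp (b * p)) ∧
      Multipliable (fun n : ℕ =>
        1 + ModularDouble.qDual b ^ (2 * n + 1) * Complex.exp (p / b)) ∧
      -- sign `Re b < 0`: the kernel `e^{ipξ/π}`
      (b.re < 0 →
        ModularDouble.psi b ε p * ModularDouble.qExp (ModularDouble.qDual b) (Complex.exp (p / b)) =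
          ModularDouble.qExp (ModularDouble.qParam b) (Complex.exp (b * p)) ∧
        (ModularDouble.qExp (ModularDouble.qDual b) (Complex.exp (p / b)) ≠ 0 →
          ModularDouble.psi b ε p =
            ModularDouble.qExp (ModularDouble.qParam b) (Complex.exp (b * p)) /
              ModularDouble.qExp (ModularDouble.qDual b) (Complex.exp (p / b)))) ∧
      -- sign `Re b > 0`: the kernel `e^{-ipξ/π}`
      (0 < b.re →
        ModularDouble.psi b ε (-p) *
            ModularDouble.qExp (ModularDouble.qDual b) (Complex.exp (p / b)) =
          ModularDouble.qExp (ModularDouble.qParam b) (Complex.exp (b * p)) ∧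
        (ModularDouble.qExp (ModularDouble.qDual b) (Complex.exp (p / b)) ≠ 0 →
          ModularDouble.psi b ε (-p) =
            ModularDouble.qExp (ModularDouble.qParam b) (Complex.exp (b * p)) /
              ModularDouble.qExp (ModularDouble.qDual b) (Complex.exp (p / b))))) ∧
    -- no small denominators: `ψ` is well defined and regular for all `b` with `Re b ≠ 0`,
    -- in particular for real `b`, where `|q| = 1`
    (∀ (b : ℂ), b.re ≠ 0 →
      (∃ ε : ℝ, ModularDouble.AdmissibleHeight b ε) ∧
      ∀ ε : ℝ, ModularDouble.AdmissibleHeight b ε →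
        (∀ p : ℂ, ModularDouble.InStrip b p →
          MeasureTheory.Integrable
            (fun x : ℝ => ModularDouble.psiIntegrand b p (x + ε * Complex.I))) ∧
        (∀ (ε' : ℝ) (p : ℂ), ModularDouble.AdmissibleHeight b ε' → ModularDouble.InStrip b p →
          ModularDouble.psi b ε' p = ModularDouble.psi b ε p) ∧
        DifferentiableOn ℂ (ModularDouble.psi b ε) {p : ℂ | ModularDouble.InStrip b p}) ∧
    -- `ψ` depends continuously on `(b, p)` jointly, across the locus `|q| = 1`
    (∀ ε : ℝ, ContinuousOn (fun z : ℂ × ℂ => ModularDouble.psi z.1 ε z.2)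
      {z : ℂ × ℂ | ModularDouble.AdmissibleHeight z.1 ε ∧ ModularDouble.InStrip z.1 z.2}) := by
  open ModularDouble in
  refine ⟨fun b ε p hb2 h hp => ?_, fun b hb => ⟨exists_admissibleHeight hb, fun ε h => ?_⟩,
    fun ε z hz => (continuousAt_psi hz.1 hz.2).continuousWithinAt⟩
  · refine ⟨⟨norm_qParam_lt_one hb2, norm_qDual_lt_one hb2⟩,
      multipliable_qExp (norm_qParam_lt_one hb2) _, multipliable_qExp (norm_qDual_lt_one hb2) _,
      fun hb => ?_, fun hb => ?_⟩
    -- ψ, q and q̃ are unchanged under b ↦ -b, while e^{-bp} and e^{-p/b} turn into e^{bp} and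
    -- e^{p/b}.
    · have hadm : AdmissibleHeight (-b) ε :=
        ⟨h.1, by simpa using h.2.1, by simpa [inv_neg] using h.2.2⟩
      have key := psi_mul_qExp_eq (b := -b) (p := p) (by simpa using hb) (by simpa using hb2) hadm
        (by simpa [InStrip, inv_neg] using hp)
      simp only [psi_neg, qDual, qParam, neg_sq, div_neg, neg_mul, neg_neg] at key
      exact ⟨key, fun h0 => (eq_div_iff h0).2 key⟩
    · have key := psi_mul_qExp_eq (p := -p) hb hb2 h (by simpa [InStrip] using hp)
      simp only [neg_div, mul_neg, neg_neg] at key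
      exact ⟨key, fun h0 => (eq_div_iff h0).2 key⟩
  · exact ⟨fun p hp => integrable_psiIntegrand h hp,
      fun ε' p h' hp => psi_eq_of_admissibleHeight h' h hp,
      fun p hp => (differentiableAt_psi h hp).differentiableWithinAt⟩
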